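/- **Setting.** Fix a countably infinite set $\Delta$ of constants, a finite set $\mathcal F$ of service functions with arities, and finitely many context dimensions $d\in\mathbb D$, each with a finite tree-shaped value domain ($v\prec v'$: $v'$ is the parent of $v$). A context $C$ assigns one value to every dimension; context expressions are built from letters $d\mapsto v$ with $\land,\lnot$. $\Phi$ is the theory consisting of $(d\mapsto v)\to(d\mapsto v')$ for $v\prec v'$ and $(d\mapsto v_1)\to\lnot(d\mapsto v_2)$ for distinct siblings $v_1,v_2$. A *contextualized TBox* $T$ is a finite set of pairs $\langle t:\varphi\rangle$, where $t$ is an inclusion $B_1\sqsubseteq B_2$, $R_1\sqsubseteq R_2$, $B_1\sqsubseteq\lnot B_2$, $R_1\sqsubseteq\lnot R_2$ or $(\mathsf{funct}\ R)$ over basic concepts $B::=N\mid\exists R$ and basic roles $R::=P\mid P^-$, and $\varphi$ is a context expression; $T^C=\{t\mid\langle t:\varphi\rangle\in T,\ C\cup\Phi\models\varphi\}$. Every $T^C$ is a DL-Lite$_{\mathcal A}$ TBox: if $(\mathsf{funct}\ R)\in T^C$, then neither $R$ nor $R^-$ is the right-hand side of a positive role inclusion of $T^C$. Semantics is first-order with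 unique names. UCQs $q$ have certain answers (constants of the active domain $\mathrm{adom}(A)$ for which $q$ is true in all models of $(T^C,A)$). ECQs $Q::=[q]\mid\lnot Q\mid Q\land Q\mid\exists x.Q$ are evaluated as first-order formulas over the certain answers of their UCQs, with quantifiers ranging over $\mathrm{adom}(A)$; answers are taken from $\mathrm{adom}(A)$. A *CKAB* $\mathcal K=\langle T,A_0,\Gamma,\Pi,C_0,\Omega\rangle$ consists of a contextualized TBox $T$, an initial ABox $A_0$, a finite set $\Gamma$ of actions $\alpha(p_1,\dots,p_n):\{e_1,\dots,e_m\}$ with effects $e_i=[q_i^+]\land Q_i^-\rightsquigarrow A_i$ ($q_i^+$ a UCQ, $Q_i^-$ an ECQ, $A_i$ a finite set of facts whose terms are constants, parameters, free variables of $q_i^+$, and service calls applied to such terms; $Q_i^-$ has no other free variables than these), a finite set $\Pi$ of rules $\langle Q(\vec x),\varphi\rangle\mapsto\alpha(\vec x)$ where the free variables of the ECQ $Q$ are exactly the parameters of $\alpha$, an initial context $C_0$, and a finite set $\Omega$ of rules $\langle Q,\varphi\rangle\mapsto C_{new}$ with $Q$ boolean and $C_{new}$ a partial assignment of values to dimensions.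 **Transition system.** States are $\langle id,A,m,C\rangle$, where $m$ is a partial map from ground service calls to $\Delta$. The initial state is $\langle id_0,A_0,\emptyset,C_0\rangle$. From a non-intermediate state $\langle id,A,m,C\rangle$, an action $\alpha$ is executable with parameter substitution $\sigma$ if some rule $\langle Q,\varphi\rangle\mapsto\alpha$ in $\Pi$ has $\vec x\sigma\in\mathrm{Ans}(Q,T^C,A)$ and $C\cup\Phi\models\varphi$. Let $\mathrm{DO}=\bigcup_i\bigcup_{\rho\in\mathrm{Ans}(([q_i^+]\land Q_i^-)\sigma,T^C,A)}A_i\sigma\rho$; for any total function $\theta$ from the service calls in $\mathrm{DO}$ to $\Delta$ that agrees with $m$ on common arguments, put $A'=\mathrm{DO}\,\theta$ and $m'=m\cup\theta$. A context transition $C\to C'$ over $A'$ is possible if some $\langle Q,\varphi\rangle\mapsto C_{new}$ in $\Omega$ has $\mathrm{Ans}(Q,T^C,A')$ true and $C\cup\Phi\models\varphi$, and $C'$ agrees with $C_{new}$ where that is defined and with $C$ elsewhere. If at least one possible $C'$ makes $A'$ consistent with $T^{C'}$, then there is a transition to the intermediate state $\langle id',A'\cup\{\mathsf{State}(\mathsf{inter})\},m',C\rangle$,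 and from there one to $\langle id'',A',m',C'\rangle$ for each possible $C'$ such that $A'$ is $T^{C'}$-consistent; here $id',id''$ are fresh identifiers and $\mathsf{State},\mathsf{inter}$ a fresh concept name and a fresh constant. The states are those generated in this way. A run is a finite or infinite sequence of states $s_0s_1\cdots$ from the initial state along transitions. The system is *run-bounded* if there is a $b\in\mathbb N$ such that for every run $\tau$ fewer than $b$ constants appear in the ABoxes of all states of $\tau$ together. **Dependency graph.** Nodes are the positions: one for each concept name, two for each role name. For an effect $[q^+]\land Q^-\rightsquigarrow A$ of an action in $\Gamma$ and a context $C$, let $\mathrm{rew}_C(q^+)$ be the set of conjunctive queries produced from $q^+$ by the rewriting algorithm PerfectRef for $T^C$: exhaustively replace atoms by means of applicable positive inclusions, where $B\sqsubseteq\exists R$ applies to $R(x,y)$ only if $y$ is unbound, and unify pairs of atoms by most general unifiers. A parameter or free variable $x$ *takes values from* position $p$ in $r\in\mathrm{rew}_C(q^+)$ if $x$ (or the variable that it was unified with) occurs at $p$ in $r$; if $x$ does not occur in $r$ at all, it ranges over the whole active domain and takes values from every position; if it was unified with a constant, it takes values from no position. If $x$ takes values from $p$ in some such $r$, there is an ordinary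 edge $p\to p'$ whenever $x$ is the term at position $p'$ of a fact of $A$, and a special edge $p\to p'$ whenever a service call with $x$ among its arguments is the term at position $p'$ of a fact of $A$. $\mathcal K$ is *weakly acyclic* if no cycle of this graph contains a special edge. **Theorem.** If a CKAB $\mathcal K$ is weakly acyclic, then its context-sensitive transition system is run-bounded. -/

import Mathlib

universe u

namespace Ckab

/-! ### Facts, positions, TBoxes -/

/-- Atomic facts `N(t)` and `P(t,t')` over concept names `CN`, role names `RN` and a type of
terms.  Used for ABox assertions, query atoms and heads of action effects. -/
inductive Fact (CN RN Tm : Type u) : Type u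
  | concept (N : CN) (t : Tm)
  | role (P : RN) (t t' : Tm)

/-- Positions: the only argument of a concept name, the first or second argument of a role name. -/
inductive Position (CN RN : Type u) : Type u
  | concept (N : CN)
  | fst (P : RN)
  | snd (P : RN)

/-- The fact has the term `t` as its argument at the given position. -/
inductive Fact.OccursAt {CN RN Tm : Type u} : Fact CN RN Tm → Position CN RN → Tm → Prop
  | concept (N : CN) (t : Tm) : OccursAt (.concept N t) (.concept N) t
  | fst (P : RN) (t t' : Tm) : OccursAt (.role P t t') (.fst P) t
  | snd (P : RN) (t t' : Tm) : OccursAt (.role P t t') (.snd P) t'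

/-- Apply a function to the terms of a fact. -/
def Fact.map {CN RN Tm Tm' : Type u} (h : Tm → Tm') : Fact CN RN Tm → Fact CN RN Tm'
  | .concept N t => .concept N (h t)
  | .role P t t' => .role P (h t) (h t')

/-- An ABox is a finite set of membership assertions. -/
abbrev ABox (CN RN Cst : Type u) : Type u := Finset (Fact CN RN Cst)

/-- The active domain: the set of constants appearing in an ABox. -/
def adom {CN RN Cst : Type u} (A : ABox CN RN Cst) : Set Cst :=
  {c | ∃ g ∈ A, ∃ p, g.OccursAt p c}

/-- Basic roles `P`, `P⁻`. -/
inductive Role (RN : Type u) : Type u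
  | name (P : RN)
  | inv (P : RN)

/-- The inverse of a basic role, with `(P⁻)⁻ = P`. -/
def Role.inverse {RN : Type u} : Role RN → Role RN
  | .name P => .inv P
  | .inv P => .name P

/-- Basic concepts `N`, `∃R`. -/
inductive Concept (CN RN : Type u) : Type u
  | name (N : CN)
  | ex (R : Role RN)

/-- TBox assertions: positive inclusions, negative inclusions, functionality. -/
inductive TAssertion (CN RN : Type u) : Type u
  | conceptIncl (B₁ B₂ : Concept CN RN)
  | roleIncl (R₁ R₂ : Role RN)
  | conceptDisj (B₁ B₂ : Concept CN RN)
  | roleDisj (R₁ R₂ : Role RN)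
  | funct (R : Role RN)

/-- The syntactic restriction that is part of the definition of DL-Lite_A TBoxes: a role that
is functional, or whose inverse is functional, is not specialized, i.e. neither it nor its
inverse is the right-hand side of a positive role inclusion. -/
def IsDLLiteA {CN RN : Type u} (T : Set (TAssertion CN RN)) : Prop :=
  ∀ R R' : Role RN, TAssertion.funct R ∈ T →
    TAssertion.roleIncl R' R ∉ T ∧ TAssertion.roleIncl R' R.inverse ∉ T

/-! ### Semantics of knowledge bases -/

/-- First-order interpretations, with unique names, as always in DL-Lite_A. -/
structure Interp (CN RN Cst : Type u) where
  Dom : Type u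
  cst : Cst → Dom
  una : Function.Injective cst
  con : CN → Set Dom
  rol : RN → Set (Dom × Dom)

namespace Interp

variable {CN RN Cst : Type u} (I : Interp CN RN Cst)

/-- Extension of a basic role. -/
def roleExt : Role RN → Set (I.Dom × I.Dom)
  | .name P => I.rol P
  | .inv P => {z | (z.2, z.1) ∈ I.rol P}

/-- Extension of a basic concept. -/
def conceptExt : Concept CN RN → Set I.Dom
  | .name N => I.con N
  | .ex R => {a | ∃ b, (a, b) ∈ I.roleExt R}

/-- Satisfaction of a TBox assertion. -/
def SatT : TAssertion CN RN → Prop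
  | .conceptIncl B₁ B₂ => I.conceptExt B₁ ⊆ I.conceptExt B₂
  | .roleIncl R₁ R₂ => I.roleExt R₁ ⊆ I.roleExt R₂
  | .conceptDisj B₁ B₂ => Disjoint (I.conceptExt B₁) (I.conceptExt B₂)
  | .roleDisj R₁ R₂ => Disjoint (I.roleExt R₁) (I.roleExt R₂)
  | .funct R => ∀ a b b', (a, b) ∈ I.roleExt R → (a, b') ∈ I.roleExt R → b = b'

/-- Satisfaction of a fact whose terms are domain elements. -/
def SatFact : Fact CN RN I.Dom → Prop
  | .concept N a => a ∈ I.con N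
  | .role P a b => (a, b) ∈ I.rol P

/-- `I` is a model of the knowledge base `(T, A)`. -/
def IsModel (T : Set (TAssertion CN RN)) (A : ABox CN RN Cst) : Prop :=
  (∀ t ∈ T, I.SatT t) ∧ ∀ g ∈ A, I.SatFact (g.map I.cst)

end Interp

/-- `A` is `T`-consistent. -/
def Consistent {CN RN Cst : Type u} (T : Set (TAssertion CN RN)) (A : ABox CN RN Cst) : Prop :=
  ∃ I : Interp CN RN Cst, I.IsModel T A

/-! ### Queries -/

/-- Query terms: variables and constants. -/
inductive QTerm (Cst : Type u) : Type u
  | var (x : ℕ)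
  | const (c : Cst)

/-- Value of a term under an interpretation of the variables and of the constants. -/
def QTerm.val {Cst D : Type u} (w : ℕ → D) (k : Cst → D) : QTerm Cst → D
  | .var x => w x
  | .const c => k c

/-- Substitution in a term. -/
def QTerm.subst {Cst : Type u} (σ : ℕ → QTerm Cst) : QTerm Cst → QTerm Cst
  | .var x => σ x
  | .const c => .const c

/-- Conjunctions of atoms. -/
abbrev CQ (CN RN Cst : Type u) : Type u := Finset (Fact CN RN (QTerm Cst))

/-- Unions of conjunctive queries with free variables `free`; in each disjunct, the variables
that are not in `free` are existentially quantified. -/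
structure UCQ (CN RN Cst : Type u) : Type u where
  free : Finset ℕ
  disjuncts : List (CQ CN RN Cst)

/-- The UCQ is true in `I` when its free variables have the values given by `v`. -/
def UCQ.Holds {CN RN Cst : Type u} (q : UCQ CN RN Cst) (I : Interp CN RN Cst)
    (v : ℕ → I.Dom) : Prop :=
  ∃ d ∈ q.disjuncts, ∃ w : ℕ → I.Dom, (∀ x ∈ q.free, w x = v x) ∧
    ∀ g ∈ d, I.SatFact (g.map (QTerm.val w I.cst))

/-- `q`, with its free variables replaced according to `s`, is true in every model of `(T, A)`. -/
def UCQ.Certain {CN RN Cst : Type u} (q : UCQ CN RN Cst) (T : Set (TAssertion CN RN))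
    (A : ABox CN RN Cst) (s : ℕ → Cst) : Prop :=
  ∀ I : Interp CN RN Cst, I.IsModel T A → q.Holds I (fun x => I.cst (s x))

/-- EQL-Lite(UCQ) queries. -/
inductive ECQ (CN RN Cst : Type u) : Type u
  | ucq (q : UCQ CN RN Cst)
  | not (Q : ECQ CN RN Cst)
  | and (Q₁ Q₂ : ECQ CN RN Cst)
  | ex (x : ℕ) (Q : ECQ CN RN Cst)

namespace ECQ

variable {CN RN Cst : Type u}

/-- Free variables. -/
def fv : ECQ CN RN Cst → Finset ℕ
  | .ucq q => q.free
  | .not Q => Q.fv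
  | .and Q₁ Q₂ => Q₁.fv ∪ Q₂.fv
  | .ex x Q => Q.fv.erase x

/-- The ECQ, with its free variables replaced according to `s`, evaluates to true: embedded UCQs
under the certain answer semantics, quantifiers over the active domain. -/
def Eval (T : Set (TAssertion CN RN)) (A : ABox CN RN Cst) : ECQ CN RN Cst → (ℕ → Cst) → Prop
  | .ucq q, s => q.Certain T A s
  | .not Q, s => ¬ Eval T A Q s
  | .and Q₁ Q₂, s => Eval T A Q₁ s ∧ Eval T A Q₂ s
  | .ex x Q, s => ∃ c ∈ adom A, Eval T A Q (Function.update s x c)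

/-- Certain answers of an ECQ: substitutions of active domain constants for its free variables
(the values of `s` at other variables play no role). -/
def Ans (T : Set (TAssertion CN RN)) (A : ABox CN RN Cst) (Q : ECQ CN RN Cst) : Set (ℕ → Cst) :=
  {s | (∀ x ∈ Q.fv, s x ∈ adom A) ∧ Q.Eval T A s}

end ECQ

/-! ### Rewriting of UCQs (the algorithm PerfectRef) -/

/-- The atom `R(x,y)`. -/
def Role.atom {CN RN Tm : Type u} (x y : Tm) : Role RN → Fact CN RN Tm
  | .name P => .role P x y
  | .inv P => .role P y x

/-- The atom expressing that `x` is in the basic concept, with witness `y` if it is `∃R`. -/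
def Concept.atom {CN RN Tm : Type u} (x y : Tm) : Concept CN RN → Fact CN RN Tm
  | .name N => .concept N x
  | .ex R => R.atom x y

/-- A conjunctive query under rewriting: `ans x` is the term that the original free variable `x`
has been turned into by unification. -/
structure RQuery (CN RN Cst : Type u) : Type u where
  ans : ℕ → QTerm Cst
  body : Set (Fact CN RN (QTerm Cst))

/-- The term occurs in the body of the query. -/
def RQuery.Occurs {CN RN Cst : Type u} (r : RQuery CN RN Cst) (t : QTerm Cst) : Prop :=
  ∃ g ∈ r.body, ∃ p, g.OccursAt p t

/-- The variable `z` is new for the query. -/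
def RQuery.Fresh {CN RN Cst : Type u} (r : RQuery CN RN Cst) (free : Finset ℕ) (z : ℕ) : Prop :=
  ¬ r.Occurs (.var z) ∧ ∀ a ∈ free, r.ans a ≠ .var z

/-- In the atom `g` of the query, whose arguments are `x` and `y`, the argument `y` is unbound: it
is a variable that is not distinguished and has no other occurrence in the query. -/
def RQuery.Unbound {CN RN Cst : Type u} (r : RQuery CN RN Cst) (free : Finset ℕ)
    (g : Fact CN RN (QTerm Cst)) (x y : QTerm Cst) : Prop :=
  (∃ w, y = .var w) ∧ y ≠ x ∧ (∀ a ∈ free, r.ans a ≠ y) ∧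
    ∀ g' ∈ r.body, g' ≠ g → ∀ p, ¬ g'.OccursAt p y

/-- `σ` unifies the two atoms. -/
def Unifies {CN RN Cst : Type u} (σ : ℕ → QTerm Cst) (g₁ g₂ : Fact CN RN (QTerm Cst)) : Prop :=
  g₁.map (QTerm.subst σ) = g₂.map (QTerm.subst σ)

/-- `σ` is a most general unifier of the two atoms. -/
def IsMGU {CN RN Cst : Type u} (σ : ℕ → QTerm Cst) (g₁ g₂ : Fact CN RN (QTerm Cst)) : Prop :=
  Unifies σ g₁ g₂ ∧
    ∀ τ : ℕ → QTerm Cst, Unifies τ g₁ g₂ → ∃ ρ : ℕ → QTerm Cst, ∀ x, τ x = (σ x).subst ρ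

/-- One step of PerfectRef: replace an atom using an applicable positive inclusion of `T`
(an inclusion with right-hand side `∃R` is applicable to `R(x,y)` only if `y` is unbound), or
unify two atoms of the query. -/
inductive RewStep {CN RN Cst : Type u} (T : Set (TAssertion CN RN)) (free : Finset ℕ) :
    RQuery CN RN Cst → RQuery CN RN Cst → Prop
  | concept {r : RQuery CN RN Cst} {B₁ B₂ : Concept CN RN} {x y : QTerm Cst} {z : ℕ}
      (hT : TAssertion.conceptIncl B₁ B₂ ∈ T) (hg : B₂.atom x y ∈ r.body)
      (hy : ∀ R, B₂ = .ex R → r.Unbound free (B₂.atom x y) x y) (hz : r.Fresh free z) :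
      RewStep T free r
        ⟨r.ans, insert (B₁.atom x (.var z)) (r.body \ {B₂.atom x y})⟩
  | role {r : RQuery CN RN Cst} {R₁ R₂ : Role RN} {x y : QTerm Cst}
      (hT : TAssertion.roleIncl R₁ R₂ ∈ T) (hg : R₂.atom x y ∈ r.body) :
      RewStep T free r ⟨r.ans, insert (R₁.atom x y) (r.body \ {R₂.atom x y})⟩
  | reduce {r : RQuery CN RN Cst} {g₁ g₂ : Fact CN RN (QTerm Cst)} {σ : ℕ → QTerm Cst}
      (h₁ : g₁ ∈ r.body) (h₂ : g₂ ∈ r.body) (hσ : IsMGU σ g₁ g₂) :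
      RewStep T free r
        ⟨fun x => (r.ans x).subst σ, (fun g => g.map (QTerm.subst σ)) '' r.body⟩

/-- The conjunctive queries (up to renaming of variables) of the perfect rewriting of `q`
with respect to `T`. -/
def rew {CN RN Cst : Type u} (T : Set (TAssertion CN RN)) (q : UCQ CN RN Cst) :
    Set (RQuery CN RN Cst) :=
  {r | ∃ d ∈ q.disjuncts,
    Relation.ReflTransGen (RewStep T q.free) ⟨QTerm.var, {g | g ∈ d}⟩ r}

/-! ### Contexts -/

/-- Tree-shaped finite value domains; `cover v₁ v₂` says that `v₂` is the value directly above
`v₁`. -/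
structure ValueDomain where
  Val : Type
  finite : Finite Val
  cover : Val → Val → Prop
  root : Val
  root_max : ∀ v, ¬ cover root v
  parent : ∀ v, v ≠ root → ∃! v', cover v v'
  below_root : ∀ v, Relation.ReflTransGen cover v root

/-- A context assigns exactly one value to each context dimension. -/
abbrev Context {D : Type} (V : D → ValueDomain) : Type := ∀ d, (V d).Val

/-- Context expressions. -/
inductive CtxExpr {D : Type} (V : D → ValueDomain) : Type
  | is (d : D) (v : (V d).Val)
  | and (φ ψ : CtxExpr V)
  | not (φ : CtxExpr V)

namespace CtxExpr

variable {D : Type} {V : D → ValueDomain}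

/-- Implication, as an abbreviation. -/
def imp (φ ψ : CtxExpr V) : CtxExpr V := .not (.and φ (.not ψ))

/-- Propositional satisfaction under a truth assignment to the letters `d ↦ v`. -/
def Sat (w : ∀ d, (V d).Val → Prop) : CtxExpr V → Prop
  | .is d v => w d v
  | .and φ ψ => φ.Sat w ∧ ψ.Sat w
  | .not φ => ¬ φ.Sat w

end CtxExpr

/-- The theory expressing the semantics of the value domains. -/
inductive CtxTheory {D : Type} (V : D → ValueDomain) : CtxExpr V → Prop
  | up (d : D) (v₁ v₂ : (V d).Val) (h : (V d).cover v₁ v₂) :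
      CtxTheory V (.imp (.is d v₁) (.is d v₂))
  | siblings (d : D) (v₁ v₂ v : (V d).Val) (hne : v₁ ≠ v₂) (h₁ : (V d).cover v₁ v)
      (h₂ : (V d).cover v₂ v) : CtxTheory V (.imp (.is d v₁) (.not (.is d v₂)))

/-- The context, together with the theory of the value domains, propositionally entails `φ`. -/
def Context.Entails {D : Type} {V : D → ValueDomain} (C : Context V) (φ : CtxExpr V) : Prop :=
  ∀ w : ∀ d, (V d).Val → Prop, (∀ d, w d (C d)) → (∀ ψ, CtxTheory V ψ → ψ.Sat w) → φ.Sat w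

/-- Contextualized TBoxes. -/
abbrev CTBox {D : Type} (V : D → ValueDomain) (CN RN : Type u) : Type u :=
  Set (TAssertion CN RN × CtxExpr V)

/-- The TBox in the context `C`. -/
def CTBox.inCtx {D : Type} {V : D → ValueDomain} {CN RN : Type u} (T : CTBox V CN RN)
    (C : Context V) : Set (TAssertion CN RN) :=
  {t | ∃ φ, (t, φ) ∈ T ∧ C.Entails φ}

/-! ### Actions -/

/-- Terms in the heads of effects: constants, variables (parameters or free variables of the
query) and service calls applied to these; `ar f` is the arity of the service `f`. -/
inductive HTerm (Cst : Type u) {F : Type u} (ar : F → ℕ) : Type u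
  | base (t : QTerm Cst)
  | call (f : F) (args : Fin (ar f) → QTerm Cst)

/-- The variable occurs in the term. -/
def HTerm.HasVar {Cst F : Type u} {ar : F → ℕ} (x : ℕ) : HTerm Cst ar → Prop
  | .base t => t = .var x
  | .call _ args => ∃ i, args i = .var x

/-- Ground service calls. -/
structure SCall (Cst : Type u) {F : Type u} (ar : F → ℕ) : Type u where
  fn : F
  args : Fin (ar fn) → Cst

/-- Ground terms: constants and ground service calls. -/
inductive GTerm (Cst : Type u) {F : Type u} (ar : F → ℕ) : Type u
  | const (c : Cst)
  | call (s : SCall Cst ar)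

/-- Grounding of a term. -/
def HTerm.ground {Cst F : Type u} {ar : F → ℕ} (s : ℕ → Cst) : HTerm Cst ar → GTerm Cst ar
  | .base t => .const (t.val s id)
  | .call f args => .call ⟨f, fun i => (args i).val s id⟩

/-- Service call maps: partial functions from ground service calls to constants. -/
abbrev SMap (Cst : Type u) {F : Type u} (ar : F → ℕ) : Type u := SCall Cst ar → Option Cst

/-- Value of a ground term when service calls are answered by `θ`. -/
def GTerm.resolve {Cst F : Type u} {ar : F → ℕ} (θ : SMap Cst ar) : GTerm Cst ar → Option Cst
  | .const c => some c
  | .call s => θ s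

/-- Effects `[q⁺] ∧ Q⁻ ⇝ facts`. -/
structure Effect (CN RN Cst : Type u) {F : Type u} (ar : F → ℕ) : Type u where
  pos : UCQ CN RN Cst
  neg : ECQ CN RN Cst
  facts : Finset (Fact CN RN (HTerm Cst ar))

/-- Actions; the input parameters are variables. -/
structure Action (CN RN Cst : Type u) {F : Type u} (ar : F → ℕ) : Type u where
  name : ℕ
  params : Finset ℕ
  effects : List (Effect CN RN Cst ar)
  neg_scope : ∀ e ∈ effects, e.neg.fv ⊆ e.pos.free ∪ params
  facts_scope : ∀ e ∈ effects, ∀ g ∈ e.facts, ∀ p t, g.OccursAt p t →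
    ∀ x, t.HasVar x → x ∈ e.pos.free ∪ params

namespace Action

variable {CN RN Cst F : Type u} {ar : F → ℕ}

/-- Parameter substitutions. -/
abbrev Subst (α : Action CN RN Cst ar) : Type u := {x // x ∈ α.params} → Cst

/-- `s` extends the parameter substitution `σ`. -/
def Extends (α : Action CN RN Cst ar) (σ : α.Subst) (s : ℕ → Cst) : Prop :=
  ∀ x : {x // x ∈ α.params}, s x = σ x

/-- The set `DO(T, A, ασ)` of facts, possibly with ground service calls. -/
def doSet (T : Set (TAssertion CN RN)) (A : ABox CN RN Cst) (α : Action CN RN Cst ar)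
    (σ : α.Subst) : Set (Fact CN RN (GTerm Cst ar)) :=
  {G | ∃ e ∈ α.effects, ∃ s : ℕ → Cst, α.Extends σ s ∧
    (∀ x ∈ e.pos.free, x ∉ α.params → s x ∈ adom A) ∧
    (ECQ.and (.ucq e.pos) e.neg).Eval T A s ∧
    ∃ g ∈ e.facts, G = g.map (HTerm.ground s)}

/-- The ground service calls in `DO(T, A, ασ)`. -/
def calls (T : Set (TAssertion CN RN)) (A : ABox CN RN Cst) (α : Action CN RN Cst ar)
    (σ : α.Subst) : Set (SCall Cst ar) :=
  {k | ∃ G ∈ α.doSet T A σ, ∃ p, G.OccursAt p (.call k)}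

end Action

/-! ### CKABs -/

/-- Condition-action rules. -/
structure CARule {D : Type} (V : D → ValueDomain) (CN RN Cst : Type u) {F : Type u}
    (ar : F → ℕ) : Type u where
  query : ECQ CN RN Cst
  ctx : CtxExpr V
  action : Action CN RN Cst ar

/-- Context-evolution rules; `new d = none` if dimension `d` is not assigned. -/
structure CtxRule {D : Type} (V : D → ValueDomain) (CN RN Cst : Type u) : Type u where
  query : ECQ CN RN Cst
  ctx : CtxExpr V
  new : ∀ d, Option (V d).Val

/-- Context-sensitive knowledge and action bases. -/
structure CKAB {D : Type} (V : D → ValueDomain) (CN RN Cst : Type u) {F : Type u}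
    (ar : F → ℕ) : Type u where
  tbox : CTBox V CN RN
  tbox_finite : tbox.Finite
  tbox_dlLiteA : ∀ C : Context V, IsDLLiteA (tbox.inCtx C)
  abox₀ : ABox CN RN Cst
  actions : Set (Action CN RN Cst ar)
  actions_finite : actions.Finite
  process : Set (CARule V CN RN Cst ar)
  process_finite : process.Finite
  process_actions : ∀ r ∈ process, r.action ∈ actions
  process_params : ∀ r ∈ process, r.query.fv = r.action.params
  ctx₀ : Context V
  ctxRules : Set (CtxRule V CN RN Cst)
  ctxRules_finite : ctxRules.Finite
  ctxRules_boolean : ∀ r ∈ ctxRules, r.query.fv = ∅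

/-! ### Transition systems -/

/-- Context-sensitive transition systems with states taken from `S`. -/
structure TransSys {D : Type} (V : D → ValueDomain) (CN RN CN' Cst' S : Type u) : Type u where
  tbox : CTBox V CN RN
  states : Set S
  init : S
  abox : S → ABox CN' RN Cst'
  cntx : S → Context V
  trans : S → S → Prop

/-- A (possibly infinite) run: the sequence of states `st 0, st 1, …`, with indices up to `len`. -/
structure TransSys.Run {D : Type} {V : D → ValueDomain} {CN RN CN' Cst' S : Type u}
    (Y : TransSys V CN RN CN' Cst' S) : Type u where
  len : ℕ∞
  st : ℕ → S
  start : st 0 = Y.init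
  mem : ∀ i : ℕ, (i : ℕ∞) ≤ len → st i ∈ Y.states
  step : ∀ i : ℕ, (i : ℕ∞) < len → Y.trans (st i) (st (i + 1))

/-- The constants that appear in the ABoxes of the states of a run. -/
def TransSys.Run.values {D : Type} {V : D → ValueDomain} {CN RN CN' Cst' S : Type u}
    {Y : TransSys V CN RN CN' Cst' S} (τ : Y.Run) : Set Cst' :=
  {c | ∃ i : ℕ, (i : ℕ∞) ≤ τ.len ∧ c ∈ adom (Y.abox (τ.st i))}

/-- Run-boundedness: one finite bound for all runs. -/
def TransSys.RunBounded {D : Type} {V : D → ValueDomain} {CN RN CN' Cst' S : Type u}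
    (Y : TransSys V CN RN CN' Cst' S) : Prop :=
  ∃ b : ℕ, ∀ τ : Y.Run, τ.values.encard < b

/-- Fresh state identifiers, realized canonically as the history of the state. -/
inductive StateId {D : Type} (V : D → ValueDomain) (CN RN Cst : Type u) {F : Type u}
    (ar : F → ℕ) : Type u
  | init
  | act (pred : StateId V CN RN Cst ar) (α : Action CN RN Cst ar) (σ : α.Subst)
      (A' : ABox CN RN Cst) (m' : SMap Cst ar)
  | ctx (pred : StateId V CN RN Cst ar) (C' : Context V)

/-- States `⟨id, A, m, C⟩`.  ABoxes of states are over the concept names and constants of the CKAB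
and one fresh concept name and one fresh constant, both represented by `none`. -/
structure State {D : Type} (V : D → ValueDomain) (CN RN Cst : Type u) {F : Type u}
    (ar : F → ℕ) : Type u where
  id : StateId V CN RN Cst ar
  abox : ABox (Option CN) RN (Option Cst)
  smap : SMap Cst ar
  cntx : Context V

/-- A fact over the signature of the CKAB as a fact over the extended signature. -/
def Fact.lift {CN RN Cst : Type u} : Fact CN RN Cst → Fact (Option CN) RN (Option Cst)
  | .concept N t => .concept (some N) (some t)
  | .role P t t' => .role P (some t) (some t')

open Classical in
/-- An ABox of the CKAB as an ABox over the extended signature. -/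
noncomputable def ABox.lift {CN RN Cst : Type u} (A : ABox CN RN Cst) :
    ABox (Option CN) RN (Option Cst) :=
  A.image Fact.lift

open Classical in
/-- The ABox `A ∪ {State(inter)}` of an intermediate state. -/
noncomputable def ABox.mark {CN RN Cst : Type u} (A : ABox CN RN Cst) :
    ABox (Option CN) RN (Option Cst) :=
  insert (.concept none none) A.lift

namespace CKAB

variable {D : Type} {V : D → ValueDomain} {CN RN Cst F : Type u} {ar : F → ℕ}
  (K : CKAB V CN RN Cst ar)

/-- The action is executable with the given parameter substitution. -/
def Executable (A : ABox CN RN Cst) (C : Context V) (α : Action CN RN Cst ar)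
    (σ : α.Subst) : Prop :=
  ∃ r ∈ K.process, r.action = α ∧
    (∃ s, α.Extends σ s ∧ s ∈ r.query.Ans (K.tbox.inCtx C) A) ∧ C.Entails r.ctx

/-- The action transition relation from `⟨A, m, C⟩` to `⟨A', m', C⟩`.  Here `θ` is a total
function on the service calls of `DO`, agrees with `m`, and `m' = m ∪ θ`. -/
def Exec (A : ABox CN RN Cst) (m : SMap Cst ar) (C : Context V) (α : Action CN RN Cst ar)
    (σ : α.Subst) (A' : ABox CN RN Cst) (m' : SMap Cst ar) : Prop :=
  K.Executable A C α σ ∧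
  ∃ θ : SMap Cst ar,
    (∀ k, (θ k).isSome ↔ k ∈ α.calls (K.tbox.inCtx C) A σ) ∧
    (∀ k c c', θ k = some c → m k = some c' → c = c') ∧
    (∀ g, g ∈ A' ↔ ∃ G ∈ α.doSet (K.tbox.inCtx C) A σ, G.map (GTerm.resolve θ) = g.map some) ∧
    ∀ k, m' k = (m k).or (θ k)

/-- The context transition relation from `⟨A, m, C⟩` to `⟨A, m, C'⟩`. -/
def CtxExec (A : ABox CN RN Cst) (C C' : Context V) : Prop :=
  ∃ r ∈ K.ctxRules, (∃ s, s ∈ r.query.Ans (K.tbox.inCtx C) A) ∧ C.Entails r.ctx ∧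
    (∀ d v, r.new d = some v → C' d = v) ∧ ∀ d, r.new d = none → C' d = C d

/-- The transitions: an action transition to an intermediate state, provided that some context
transition leads on to a consistent state, and the context transitions leaving intermediate
states. -/
inductive Trans : State V CN RN Cst ar → State V CN RN Cst ar → Prop
  | action {id A m C} {α : Action CN RN Cst ar} {σ : α.Subst} {A' m'} (hα : α ∈ K.actions)
      (h : K.Exec A m C α σ A' m')
      (hS : ∃ C', K.CtxExec A' C C' ∧ Consistent (K.tbox.inCtx C') A') :
      Trans ⟨id, A.lift, m, C⟩ ⟨.act id α σ A' m', A'.mark, m', C⟩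
  | context {id A' m' C C'} (h : K.CtxExec A' C C') (hC : Consistent (K.tbox.inCtx C') A') :
      Trans ⟨id, A'.mark, m', C⟩ ⟨.ctx id C', A'.lift, m', C'⟩

/-- The initial state. -/
noncomputable def initState : State V CN RN Cst ar :=
  ⟨.init, K.abox₀.lift, fun _ => none, K.ctx₀⟩

/-- The context-sensitive transition system of a CKAB; its states are those generated from the
initial state. -/
noncomputable def transSys : TransSys V CN RN (Option CN) (Option Cst) (State V CN RN Cst ar) where
  tbox := K.tbox
  states := {s | Relation.ReflTransGen K.Trans K.initState s}
  init := K.initState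
  abox := State.abox
  cntx := State.cntx
  trans s s' := Relation.ReflTransGen K.Trans K.initState s ∧ K.Trans s s'

/-! ### Weak acyclicity -/

/-- In the conjunctive query `r` of the rewriting of `q`, the parameter or variable `x` may take its
value from position `p`: it occurs there or, if nothing in `r` restricts it (so that it ranges over
the whole active domain), `p` is arbitrary.  A variable that has been unified with a constant
takes its value from no position. -/
def TakesFrom (q : UCQ CN RN Cst) (r : RQuery CN RN Cst) (x : ℕ) (p : Position CN RN) : Prop :=
  x ∉ q.free ∨
    ∃ y, r.ans x = .var y ∧ (r.Occurs (.var y) → ∃ g ∈ r.body, g.OccursAt p (.var y))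

/-- Ordinary edges of the dependency graph: a value may be copied from `p` to `p'`. -/
def OrdinaryEdge (p p' : Position CN RN) : Prop :=
  ∃ α ∈ K.actions, ∃ e ∈ α.effects, ∃ C : Context V, ∃ r ∈ rew (K.tbox.inCtx C) e.pos,
    ∃ g ∈ e.facts, ∃ x, g.OccursAt p' (.base (.var x)) ∧ TakesFrom e.pos r x p

/-- Special edges of the dependency graph: a value from `p` may be an argument of a service call
whose result is put at `p'`. -/
def SpecialEdge (p p' : Position CN RN) : Prop :=
  ∃ α ∈ K.actions, ∃ e ∈ α.effects, ∃ C : Context V, ∃ r ∈ rew (K.tbox.inCtx C) e.pos,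
    ∃ g ∈ e.facts, ∃ f args x, g.OccursAt p' (.call f args) ∧ (∃ i, args i = .var x) ∧
      TakesFrom e.pos r x p

/-- Weak acyclicity: no cycle of the dependency graph goes through a special edge. -/
def WeaklyAcyclic : Prop :=
  ∀ p p', K.SpecialEdge p p' →
    ¬ Relation.ReflTransGen (fun a b => K.OrdinaryEdge a b ∨ K.SpecialEdge a b) p' p

end CKAB

end Ckab

/-! A constant that an action writes at a position is a constant of an effect, a value copied from
the previous ABox, or the result of a service call on such values. By weak acyclicity, the `rank` of
a position, i.e. the number of targets of special edges with a path to it, does not drop along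
ordinary edges and grows along special ones. Service answers are remembered, so along one run they
are values of a single function `M`. By induction along the run, a value at `p` therefore arises
from `initConsts` in at most `rank p + 1` rounds of applying `M` (`Exec.mem_reachable`). Ranks are
bounded, and a round enlarges a finite set to a size bounded in terms of its former size and the
finitely many services, whatever `M` is; so one bound serves all runs.

The difficulty is that edges are read off rewritten queries, whereas effects fire on certain
answers. The link is completeness of the rewriting over consistent ABoxes
(`UCQ.Certain.exists_rew`). A certain answer gives a match of the query in the canonical model
(`canonical_isModel`). Weigh the match by the least heights of derivations of the images of its
atoms. While some image is not an ABox fact, a rewriting step lowers the weight: either it undoes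
the last inference of an atom, or, where a witness has a second occurrence, it unifies two atoms
with the same image (`Matches.mem_abox`). At the end the match lies in the ABox and shows at which
positions the values stand.

Over an inconsistent ABox every tuple is a certain answer and the edges give no information. This
can happen only at the start of a run, where all values are initial constants; it costs one round of
calls, hence the `+ 1`. -/

namespace Ckab

/-! ### Atoms -/

section Atoms

variable {CN RN Tm Tm' Tm'' : Type u}

/-- The term is an argument of the fact. -/
def Fact.Mem (t : Tm) (g : Fact CN RN Tm) : Prop := ∃ p, g.OccursAt p t

@[simp] theorem Fact.mem_concept {t x : Tm} {N : CN} :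
    (Fact.concept N x : Fact CN RN Tm).Mem t ↔ t = x := by
  constructor
  · rintro ⟨_, ⟨⟩⟩; rfl
  · rintro rfl; exact ⟨_, .concept _ _⟩

@[simp] theorem Fact.mem_role {t x y : Tm} {P : RN} :
    (Fact.role P x y : Fact CN RN Tm).Mem t ↔ t = x ∨ t = y := by
  constructor
  · rintro ⟨_, ⟨⟩⟩ <;> simp
  · rintro (rfl | rfl)
    · exact ⟨_, .fst _ _ _⟩
    · exact ⟨_, .snd _ _ _⟩

@[simp] theorem Role.mem_atom {t x y : Tm} {R : Role RN} :
    (R.atom x y : Fact CN RN Tm).Mem t ↔ t = x ∨ t = y := by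
  cases R <;> simp [Role.atom, or_comm]

theorem Concept.mem_atom (x y : Tm) (B : Concept CN RN) : (B.atom x y : Fact CN RN Tm).Mem x := by
  cases B <;> simp [Concept.atom]

theorem Concept.eq_or_eq_of_mem_atom {t x y : Tm} {B : Concept CN RN}
    (h : (B.atom x y : Fact CN RN Tm).Mem t) : t = x ∨ t = y := by
  cases B with
  | name N => exact .inl (by simpa [Concept.atom] using h)
  | ex R => simpa [Concept.atom] using h

@[simp] theorem Role.map_atom (h : Tm → Tm') (x y : Tm) (R : Role RN) :
    (R.atom x y : Fact CN RN Tm).map h = R.atom (h x) (h y) := by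
  cases R <;> rfl

@[simp] theorem Concept.map_atom (h : Tm → Tm') (x y : Tm) (B : Concept CN RN) :
    (B.atom x y : Fact CN RN Tm).map h = B.atom (h x) (h y) := by
  cases B
  · rfl
  · exact Role.map_atom _ _ _ _

theorem Role.inverse_atom (x y : Tm) (R : Role RN) :
    (R.inverse.atom x y : Fact CN RN Tm) = R.atom y x := by
  cases R <;> rfl

theorem Role.atom_eq_atom {R R' : Role RN} {x y x' y' : Tm}
    (h : (R.atom x y : Fact CN RN Tm) = R'.atom x' y') :
    (R' = R ∧ x' = x ∧ y' = y) ∨ (R' = R.inverse ∧ x' = y ∧ y' = x) := by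
  cases R <;> cases R' <;> simp_all [Role.atom, Role.inverse]

theorem Role.map_eq_atom {h : Tm → Tm'} {g : Fact CN RN Tm} {R : Role RN} {x y : Tm'}
    (e : g.map h = R.atom x y) : ∃ u v, g = R.atom u v ∧ h u = x ∧ h v = y := by
  cases R <;> cases g <;> simp_all [Role.atom, Fact.map]

theorem Fact.map_eq_concept {h : Tm → Tm'} {g : Fact CN RN Tm} {N : CN} {x : Tm'}
    (e : g.map h = .concept N x) : ∃ u, g = .concept N u ∧ h u = x := by
  cases g <;> simp_all [Fact.map]

theorem Fact.map_map (h : Tm → Tm') (k : Tm' → Tm'') (g : Fact CN RN Tm) :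
    (g.map h).map k = g.map (k ∘ h) := by
  cases g <;> rfl

theorem Fact.map_congr {h k : Tm → Tm'} {g : Fact CN RN Tm} (e : ∀ t, g.Mem t → h t = k t) :
    g.map h = g.map k := by
  cases g <;> simp_all [Fact.map]

theorem Fact.OccursAt.map {g : Fact CN RN Tm} {p : Position CN RN} {t : Tm} (h : g.OccursAt p t)
    (f : Tm → Tm') : (g.map f).OccursAt p (f t) := by
  cases h <;> constructor

theorem Fact.OccursAt.of_map {g : Fact CN RN Tm} {p : Position CN RN} {f : Tm → Tm'} {t : Tm'}
    (h : (g.map f).OccursAt p t) : ∃ u, g.OccursAt p u ∧ f u = t := by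
  cases g <;> cases h <;> exact ⟨_, by constructor, rfl⟩

theorem Fact.mem_map {g : Fact CN RN Tm} {f : Tm → Tm'} {t : Tm'} :
    (g.map f).Mem t ↔ ∃ u, g.Mem u ∧ f u = t := by
  constructor
  · rintro ⟨p, h⟩
    obtain ⟨u, hu, e⟩ := h.of_map
    exact ⟨u, ⟨p, hu⟩, e⟩
  · rintro ⟨u, ⟨p, h⟩, rfl⟩
    exact ⟨p, h.map f⟩

theorem Fact.finite_mem (g : Fact CN RN Tm) : {t | g.Mem t}.Finite := by
  cases g with
  | concept N x => simp
  | role P x y => exact (Set.toFinite {x, y}).subset fun t ht => by simpa using ht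

end Atoms

namespace Interp

variable {CN RN Cst : Type u} (I : Interp CN RN Cst)

theorem mem_roleExt {R : Role RN} {x y : I.Dom} :
    (x, y) ∈ I.roleExt R ↔ I.SatFact (R.atom x y) := by
  cases R <;> rfl

theorem mem_conceptExt {B : Concept CN RN} {x : I.Dom} :
    x ∈ I.conceptExt B ↔ ∃ y, I.SatFact (B.atom x y) := by
  cases B with
  | name N => exact ⟨fun h => ⟨x, h⟩, fun ⟨_, h⟩ => h⟩
  | ex R => exact exists_congr fun y => I.mem_roleExt

end Interp

/-! ### The canonical model -/

/-- Skolem terms: constants, and an `R`-successor of every term. -/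
inductive SkTerm (RN Cst : Type u) : Type u
  | const (c : Cst)
  | succ (R : Role RN) (t : SkTerm RN Cst)

/-- Nesting depth. -/
def SkTerm.depth {RN Cst : Type u} : SkTerm RN Cst → ℕ
  | .const _ => 0
  | .succ _ t => t.depth + 1

theorem SkTerm.succ_ne {RN Cst : Type u} (R : Role RN) (t : SkTerm RN Cst) : SkTerm.succ R t ≠ t :=
  fun h => by simpa [SkTerm.depth] using congrArg SkTerm.depth h

section Chase

variable {CN RN Cst : Type u} {T : Set (TAssertion CN RN)} {A : ABox CN RN Cst}

/-- The term has an `R`-successor already, as a constant of the ABox or as a Skolem term. -/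
def Blocked (A : ABox CN RN Cst) (R : Role RN) (x : SkTerm RN Cst) : Prop :=
  (∃ c c', R.atom c c' ∈ A ∧ x = .const c) ∨ ∃ y, x = .succ R.inverse y

/-- Derivability of a fact from the ABox by the positive inclusions, with the height of the
derivation. -/
inductive Chase (T : Set (TAssertion CN RN)) (A : ABox CN RN Cst) :
    ℕ → Fact CN RN (SkTerm RN Cst) → Prop
  -- The height starts at 1, not 0, so that merging two atoms of a query strictly lowers the total
  -- height.
  | base {g} (h : g ∈ A) : Chase T A 1 (g.map .const)
  | concept {n B N x y} (hT : TAssertion.conceptIncl B (.name N) ∈ T)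
      (h : Chase T A n (B.atom x y)) : Chase T A (n + 1) (.concept N x)
  | role {n R₁ R₂ x y} (hT : TAssertion.roleIncl R₁ R₂ ∈ T)
      (h : Chase T A n (R₁.atom x y)) : Chase T A (n + 1) (R₂.atom x y)
  -- Blocking looks only at the ABox and at the shape of `x`, never at derived facts; a negative
  -- condition on the latter would spoil the induction.
  | ex {n B R x y} (hT : TAssertion.conceptIncl B (.ex R) ∈ T)
      (h : Chase T A n (B.atom x y)) (hb : ¬ Blocked A R x) :
      Chase T A (n + 1) (R.atom x (.succ R x))

theorem Chase.pos {n G} (h : Chase T A n G) : 0 < n := by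
  cases h <;> omega

/-- A Skolem term that occurs in a derivable fact is a successor. -/
theorem Chase.succ_of_mem {n G} (h : Chase T A n G) {R : Role RN} {x : SkTerm RN Cst}
    (hm : G.Mem (.succ R x)) : ∃ m, Chase T A m (R.atom x (.succ R x)) := by
  induction h with
  | base h =>
    obtain ⟨u, -, e⟩ := Fact.mem_map.1 hm
    cases e
  | concept hT h ih =>
    refine ih ?_
    rw [Fact.mem_concept] at hm
    rw [hm]
    exact Concept.mem_atom _ _ _
  | role hT h ih => exact ih (by simpa using hm)
  | ex hT h hb ih =>
    rcases Role.mem_atom.1 hm with e | e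
    · rw [e] at ih ⊢
      exact ih (Concept.mem_atom _ _ _)
    · cases e
      exact ⟨_, .ex hT h hb⟩

/-- The canonical model of the positive inclusions. -/
def canonical (T : Set (TAssertion CN RN)) (A : ABox CN RN Cst) : Interp CN RN Cst where
  Dom := SkTerm RN Cst
  cst := .const
  una _ _ h := by cases h; rfl
  con N := {x | ∃ n, Chase T A n (.concept N x)}
  rol P := {z | ∃ n, Chase T A n (.role P z.1 z.2)}

theorem canonical_satFact {G : Fact CN RN (SkTerm RN Cst)} :
    (canonical T A).SatFact G ↔ ∃ n, Chase T A n G := by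
  cases G <;> rfl

open Classical in
/-- The homomorphism from the canonical model into a model. -/
noncomputable def SkTerm.hom (I : Interp CN RN Cst) : SkTerm RN Cst → I.Dom
  | .const c => I.cst c
  | .succ R t =>
    -- The second value is a mere default: a successor introduced by a derivation falls under the
    -- first case in every model.
    if h : ∃ b, I.SatFact (R.atom (t.hom I) b) then h.choose else t.hom I

theorem Chase.satFact_hom {I : Interp CN RN Cst} (hI : I.IsModel T A) {n G}
    (h : Chase T A n G) : I.SatFact (G.map (SkTerm.hom I)) := by
  induction h with
  | base h => rw [Fact.map_map]; exact hI.2 _ h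
  | concept hT h ih =>
    rw [Concept.map_atom] at ih
    exact hI.1 _ hT (I.mem_conceptExt.2 ⟨_, ih⟩)
  | role hT h ih =>
    rw [Role.map_atom] at ih ⊢
    exact I.mem_roleExt.1 (hI.1 _ hT (I.mem_roleExt.2 ih))
  | @ex n B R x y hT h hb ih =>
    rw [Concept.map_atom] at ih
    have hx := I.mem_conceptExt.1 (hI.1 _ hT (I.mem_conceptExt.2 ⟨_, ih⟩))
    change ∃ b, I.SatFact (R.atom (x.hom I) b) at hx
    rw [Role.map_atom, SkTerm.hom, dif_pos hx]
    exact hx.choose_spec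

theorem Chase.hom_mem_conceptExt {I : Interp CN RN Cst} (hI : I.IsModel T A) {n}
    {B : Concept CN RN} {x y} (h : Chase T A n (B.atom x y)) : x.hom I ∈ I.conceptExt B := by
  have := h.satFact_hom hI
  rw [Concept.map_atom] at this
  exact I.mem_conceptExt.2 ⟨_, this⟩

theorem Chase.hom_mem_roleExt {I : Interp CN RN Cst} (hI : I.IsModel T A) {n}
    {R : Role RN} {x y} (h : Chase T A n (R.atom x y)) : (x.hom I, y.hom I) ∈ I.roleExt R := by
  have := h.satFact_hom hI
  rw [Role.map_atom] at this
  exact I.mem_roleExt.2 this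

/-- The role facts of a role that is not specialized. -/
theorem Chase.role_cases {n} {R : Role RN} {x y : SkTerm RN Cst}
    (hR : ∀ R', TAssertion.roleIncl R' R ∉ T ∧ TAssertion.roleIncl R' R.inverse ∉ T)
    (h : Chase T A n (R.atom x y)) :
    (∃ c c', R.atom c c' ∈ A ∧ x = .const c ∧ y = .const c') ∨
      (y = .succ R x ∧ ¬ Blocked A R x) ∨ x = .succ R.inverse y := by
  generalize hG : (R.atom x y : Fact CN RN (SkTerm RN Cst)) = G at h
  cases h with
  | base h =>
    obtain ⟨u, v, rfl, rfl, rfl⟩ := Role.map_eq_atom hG.symm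
    exact .inl ⟨u, v, h, rfl, rfl⟩
  | concept => cases R <;> simp [Role.atom] at hG
  | role hT h =>
    rcases Role.atom_eq_atom hG with ⟨rfl, -⟩ | ⟨rfl, -⟩
    · exact absurd hT (hR _).1
    · exact absurd hT (hR _).2
  | ex hT h hb =>
    rcases Role.atom_eq_atom hG with ⟨rfl, rfl, rfl⟩ | ⟨rfl, rfl, rfl⟩
    · exact .inr (.inl ⟨rfl, hb⟩)
    · exact .inr (.inr rfl)

/-- Positive inclusions hold by construction, and disjointness is pulled back from a given model
along the homomorphism. A functional role is not specialized, so its facts come from the ABox or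
from Skolem successors; blocking keeps these sources from giving two successors to one term. -/
theorem canonical_isModel (hT : IsDLLiteA T) (hA : Consistent T A) :
    (canonical T A).IsModel T A := by
  obtain ⟨I, hI⟩ := hA
  refine ⟨fun t ht => ?_, fun g hg => canonical_satFact.2 ⟨1, .base hg⟩⟩
  cases t with
  | conceptIncl B₁ B₂ =>
    intro x hx
    rw [Interp.mem_conceptExt] at hx ⊢
    obtain ⟨y, hy⟩ := hx
    obtain ⟨n, hn⟩ := canonical_satFact.1 hy
    cases B₂ with
    | name N => exact ⟨x, canonical_satFact.2 ⟨_, .concept ht hn⟩⟩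
    | ex R =>
      by_cases hb : Blocked A R x
      · rcases hb with ⟨c, c', h, rfl⟩ | ⟨z, rfl⟩
        · have := Chase.base (T := T) h
          rw [Role.map_atom] at this
          exact ⟨.const c', canonical_satFact.2 ⟨_, this⟩⟩
        -- A Skolem term created as an `R.inverse`-successor of `z` has `z` itself as an
        -- `R`-successor.
        · obtain ⟨m, hm⟩ := hn.succ_of_mem (Concept.mem_atom _ _ _)
          rw [Role.inverse_atom] at hm
          exact ⟨z, canonical_satFact.2 ⟨m, hm⟩⟩
      · exact ⟨_, canonical_satFact.2 ⟨_, .ex ht hn hb⟩⟩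
  | roleIncl R₁ R₂ =>
    rintro ⟨x, y⟩ h
    rw [Interp.mem_roleExt] at h ⊢
    obtain ⟨n, hn⟩ := canonical_satFact.1 h
    exact canonical_satFact.2 ⟨_, .role ht hn⟩
  | conceptDisj B₁ B₂ =>
    refine Set.disjoint_left.2 fun x h₁ h₂ => ?_
    have aux : ∀ {B : Concept CN RN}, x ∈ (canonical T A).conceptExt B →
        SkTerm.hom I x ∈ I.conceptExt B := by
      intro B h
      obtain ⟨y, hy⟩ := (Interp.mem_conceptExt _).1 h
      obtain ⟨n, hn⟩ := canonical_satFact.1 hy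
      exact hn.hom_mem_conceptExt hI
    exact Set.disjoint_left.1 (hI.1 _ ht) (aux h₁) (aux h₂)
  | roleDisj R₁ R₂ =>
    refine Set.disjoint_left.2 fun ⟨x, y⟩ h₁ h₂ => ?_
    have aux : ∀ {R : Role RN}, (x, y) ∈ (canonical T A).roleExt R →
        (SkTerm.hom I x, SkTerm.hom I y) ∈ I.roleExt R := by
      intro R h
      obtain ⟨n, hn⟩ := canonical_satFact.1 ((Interp.mem_roleExt _).1 h)
      exact hn.hom_mem_roleExt hI
    exact Set.disjoint_left.1 (hI.1 _ ht) (aux h₁) (aux h₂)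
  | funct R =>
    intro x y y' h h'
    have hR := fun R' => hT R R' ht
    obtain ⟨n, hn⟩ := canonical_satFact.1 ((Interp.mem_roleExt _).1 h)
    obtain ⟨n', hn'⟩ := canonical_satFact.1 ((Interp.mem_roleExt _).1 h')
    -- Of the nine combinations only the diagonal ones survive. Two ABox facts are compared in the
    -- model `I`, where functionality and unique names identify the successors.
    rcases hn.role_cases hR with ⟨c, d, hA, hx, hy⟩ | ⟨hy, hb⟩ | hx <;>
      rcases hn'.role_cases hR with ⟨c', d', hA', hx', hy'⟩ | ⟨hy', hb'⟩ | hx'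
    · have hc : c = c' := by
        have := hx.symm.trans hx'
        cases this; rfl
      subst hc
      have e₁ := hI.2 _ hA
      have e₂ := hI.2 _ hA'
      rw [Role.map_atom] at e₁ e₂
      have := I.una (hI.1 _ ht _ _ _ (I.mem_roleExt.2 e₁) (I.mem_roleExt.2 e₂))
      rw [hy, hy', this]
    · exact absurd (.inl ⟨c, d, hA, hx⟩) hb'
    · cases hx.symm.trans hx'
    · exact absurd (.inl ⟨c', d', hA', hx'⟩) hb
    · rw [hy, hy']
    · exact absurd (.inr ⟨_, hx'⟩) hb
    · cases hx.symm.trans hx'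
    · exact absurd (.inr ⟨_, hx⟩) hb'
    · have := hx.symm.trans hx'
      cases this; rfl

end Chase

/-! ### Most general unifiers -/

section Unification

variable {CN RN Cst X : Type u} {g₁ g₂ : Fact CN RN (QTerm Cst)}

/-- The pairs of terms that a unifier of the two atoms has to identify. -/
def UnifRel (g₁ g₂ : Fact CN RN (QTerm Cst)) (t t' : QTerm Cst) : Prop :=
  ∃ p, g₁.OccursAt p t ∧ g₂.OccursAt p t'

/-- Stated for arbitrary maps because it is applied both to substitutions and to valuations. -/
theorem UnifRel.eqvGen_eq {f : QTerm Cst → X} (e : g₁.map f = g₂.map f) {t t' : QTerm Cst}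
    (h : Relation.EqvGen (UnifRel g₁ g₂) t t') : f t = f t' := by
  induction h with
  | rel t t' h =>
    obtain ⟨p, h₁, h₂⟩ := h
    cases h₁ <;> cases h₂ <;> simp_all [Fact.map]
  | refl => rfl
  | symm _ _ _ ih => exact ih.symm
  | trans _ _ _ _ _ ih₁ ih₂ => exact ih₁.trans ih₂

/-- The role of `e` is to guarantee that the two atoms have the same predicate. -/
theorem map_eq_map_of_unifRel {Y : Type u} {f : QTerm Cst → X} (e : g₁.map f = g₂.map f)
    {h : QTerm Cst → Y} (H : ∀ t t', UnifRel g₁ g₂ t t' → h t = h t') : g₁.map h = g₂.map h := by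
  cases g₁ with
  | concept N t =>
    cases g₂ with
    | concept N' t' =>
      simp only [Fact.map, Fact.concept.injEq] at e ⊢
      obtain ⟨rfl, -⟩ := e
      exact ⟨rfl, H _ _ ⟨_, .concept _ _, .concept _ _⟩⟩
    | role => cases e
  | role P t u =>
    cases g₂ with
    | concept => cases e
    | role P' t' u' =>
      simp only [Fact.map, Fact.role.injEq] at e ⊢
      obtain ⟨rfl, -⟩ := e
      exact ⟨rfl, H _ _ ⟨_, .fst _ _ _, .fst _ _ _⟩, H _ _ ⟨_, .snd _ _ _, .snd _ _ _⟩⟩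

/-- Terms outside the two atoms form singleton classes, which is why unification brings in no
foreign constant. -/
theorem UnifRel.eq_or_mem {t t' : QTerm Cst} (h : Relation.EqvGen (UnifRel g₁ g₂) t t') :
    t = t' ∨ ((g₁.Mem t ∨ g₂.Mem t) ∧ (g₁.Mem t' ∨ g₂.Mem t')) := by
  induction h with
  | rel t t' h => exact .inr ⟨.inl ⟨_, h.choose_spec.1⟩, .inr ⟨_, h.choose_spec.2⟩⟩
  | refl => exact .inl rfl
  | symm _ _ _ ih => exact ih.imp Eq.symm And.symm
  | trans _ _ _ _ _ ih₁ ih₂ =>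
    rcases ih₁ with rfl | ⟨h₁, h₁'⟩
    · exact ih₂
    · rcases ih₂ with rfl | ⟨-, h₂⟩
      · exact .inr ⟨h₁, h₁'⟩
      · exact .inr ⟨h₁, h₂⟩

open Classical in
/-- The representative of the class of a term, a constant if possible. -/
noncomputable def unifRepr (g₁ g₂ : Fact CN RN (QTerm Cst)) (t : QTerm Cst) : QTerm Cst :=
  if h : ∃ c, Relation.EqvGen (UnifRel g₁ g₂) t (.const c) then .const h.choose
  else (Quotient.mk (Relation.EqvGen.setoid (UnifRel g₁ g₂)) t).out

theorem eqvGen_unifRepr (t : QTerm Cst) :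
    Relation.EqvGen (UnifRel g₁ g₂) t (unifRepr g₁ g₂ t) := by
  unfold unifRepr
  split_ifs with h
  · exact h.choose_spec
  · exact .symm _ _ (Quotient.mk_out (s := Relation.EqvGen.setoid (UnifRel g₁ g₂)) t)

theorem QTerm.val_subst {D : Type u} {w : ℕ → D} {k : Cst → D} {σ : ℕ → QTerm Cst}
    (h : ∀ x, (σ x).val w k = w x) (t : QTerm Cst) : (t.subst σ).val w k = t.val w k := by
  cases t
  · exact h _
  · rfl

/-- Two atoms with a common instance have a most general unifier, through which the instance
factors and which introduces no constants. -/
theorem exists_isMGU {D : Type u} {w : ℕ → D} {k : Cst → D} (hk : Function.Injective k)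
    (e : g₁.map (QTerm.val w k) = g₂.map (QTerm.val w k)) :
    ∃ σ : ℕ → QTerm Cst, IsMGU σ g₁ g₂ ∧ (∀ x, (σ x).val w k = w x) ∧
      ∀ x c, σ x = .const c → g₁.Mem (.const c) ∨ g₂.Mem (.const c) := by
  -- The common instance under the injective `k` shows that a class contains at most one constant,
  -- so constants are their own representatives.
  have hconst : ∀ c c', Relation.EqvGen (UnifRel g₁ g₂) (.const c) (.const c') → c = c' :=
    fun c c' h => hk (UnifRel.eqvGen_eq e h)
  have hsubst : QTerm.subst (fun x => unifRepr g₁ g₂ (.var x)) = unifRepr g₁ g₂ := by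
    funext t
    cases t with
    | var x => rfl
    | const c =>
      have h : ∃ c', Relation.EqvGen (UnifRel g₁ g₂) (.const c) (.const c') := ⟨c, .refl _⟩
      rw [unifRepr, dif_pos h, QTerm.subst, ← hconst _ _ h.choose_spec]
  -- A unifier `τ` is constant on classes, so it factors through the representatives with `τ` itself
  -- as second factor.
  refine ⟨fun x => unifRepr g₁ g₂ (.var x), ⟨?_, fun τ hτ => ⟨τ, fun x => ?_⟩⟩, fun x => ?_,
    fun x c hc => ?_⟩
  · rw [Unifies, hsubst]
    refine map_eq_map_of_unifRel e fun t t' h => ?_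
    have h := Relation.EqvGen.rel _ _ h
    unfold unifRepr
    by_cases ht : ∃ c, Relation.EqvGen (UnifRel g₁ g₂) t (.const c)
    · have ht' : ∃ c, Relation.EqvGen (UnifRel g₁ g₂) t' (.const c) :=
        ht.imp fun c hc => .trans _ _ _ (.symm _ _ h) hc
      rw [dif_pos ht, dif_pos ht', hconst _ _ (.trans _ _ _ (.trans _ _ _
        (.symm _ _ ht.choose_spec) h) ht'.choose_spec)]
    · have ht' : ¬ ∃ c, Relation.EqvGen (UnifRel g₁ g₂) t' (.const c) :=
        fun ⟨c, hc⟩ => ht ⟨c, .trans _ _ _ h hc⟩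
      rw [dif_neg ht, dif_neg ht']
      exact congrArg _ (Quotient.sound (s := Relation.EqvGen.setoid (UnifRel g₁ g₂)) h)
  · exact UnifRel.eqvGen_eq (f := QTerm.subst τ) hτ (eqvGen_unifRepr (.var x))
  · exact (UnifRel.eqvGen_eq e (eqvGen_unifRepr (.var x))).symm
  · have h := eqvGen_unifRepr (g₁ := g₁) (g₂ := g₂) (.var x)
    rw [show unifRepr g₁ g₂ (.var x) = .const c from hc] at h
    rcases UnifRel.eq_or_mem h with h | ⟨-, h⟩
    · cases h
    · exact h

end Unification

/-! ### Completeness of the rewriting -/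

section Rewriting

variable {CN RN Cst : Type u} {T : Set (TAssertion CN RN)} {A : ABox CN RN Cst}

/-- The least height of a derivation of the fact. -/
noncomputable def chaseRank (T : Set (TAssertion CN RN)) (A : ABox CN RN Cst)
    (G : Fact CN RN (SkTerm RN Cst)) : ℕ :=
  sInf {n | Chase T A n G}

theorem Chase.chaseRank_le {n G} (h : Chase T A n G) : chaseRank T A G ≤ n := Nat.sInf_le h

theorem Chase.chase_chaseRank {n G} (h : Chase T A n G) : Chase T A (chaseRank T A G) G :=
  Nat.sInf_mem (s := {n | Chase T A n G}) ⟨n, h⟩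

/-- The last step of a derivation of least height. -/
theorem Chase.cases_chaseRank {n G} (h : Chase T A n G) :
    (∃ g ∈ A, G = g.map .const) ∨
    (∃ B N x y, TAssertion.conceptIncl B (.name N) ∈ T ∧ G = .concept N x ∧
      ∃ m < chaseRank T A G, Chase T A m (B.atom x y)) ∨
    (∃ R₁ R₂ x y, TAssertion.roleIncl R₁ R₂ ∈ T ∧ G = R₂.atom x y ∧
      ∃ m < chaseRank T A G, Chase T A m (R₁.atom x y)) ∨
    ∃ B R x y, TAssertion.conceptIncl B (.ex R) ∈ T ∧ G = R.atom x (.succ R x) ∧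
      ∃ m < chaseRank T A G, Chase T A m (B.atom x y) := by
  have h' := h.chase_chaseRank
  generalize chaseRank T A G = k at h'
  cases h' with
  | base h' => exact .inl ⟨_, h', rfl⟩
  | concept hT h' => exact .inr (.inl ⟨_, _, _, _, hT, rfl, _, Nat.lt_succ_self _, h'⟩)
  | role hT h' => exact .inr (.inr (.inl ⟨_, _, _, _, hT, rfl, _, Nat.lt_succ_self _, h'⟩))
  | ex hT h' => exact .inr (.inr (.inr ⟨_, _, _, _, hT, rfl, _, Nat.lt_succ_self _, h'⟩))

/-- The query has a match in the canonical model that gives the answer `s`, and its constants are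
in `K`. -/
structure Matches (T : Set (TAssertion CN RN)) (A : ABox CN RN Cst) (free : Finset ℕ)
    (K : Set Cst) (s : ℕ → Cst) (ans : ℕ → QTerm Cst) (b : CQ CN RN Cst)
    (w : ℕ → SkTerm RN Cst) : Prop where
  chase : ∀ g ∈ b, ∃ n, Chase T A n (g.map (QTerm.val w .const))
  ans_val : ∀ x ∈ free, (ans x).val w .const = .const (s x)
  body_const : ∀ g ∈ b, ∀ c, g.Mem (.const c) → c ∈ K
  ans_const : ∀ x ∈ free, ∀ c, ans x = .const c → c ∈ K

/-- Total height of the derivations of the atoms. -/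
noncomputable def weight (T : Set (TAssertion CN RN)) (A : ABox CN RN Cst) (b : CQ CN RN Cst)
    (w : ℕ → SkTerm RN Cst) : ℕ :=
  ∑ g ∈ b, chaseRank T A (g.map (QTerm.val w .const))

variable {free : Finset ℕ} {K : Set Cst} {s : ℕ → Cst} {ans : ℕ → QTerm Cst} {b : CQ CN RN Cst}
  {w : ℕ → SkTerm RN Cst}

/-! ### Rewriting steps that lower the weight of a match. -/

open Classical in
-- The image of the new atom has a derivation lower than that of the old one, and the other images
-- stay, since `w'` differs from `w` only off the terms of the query. If `g'` is already present,
-- the sum is smaller still.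
theorem Matches.replace (h : Matches T A free K s ans b w) {g g' : Fact CN RN (QTerm Cst)}
    (hg : g ∈ b) {w' : ℕ → SkTerm RN Cst}
    (hw : ∀ g ∈ b, ∀ t, g.Mem t → t.val w' .const = t.val w .const)
    (hans : ∀ x ∈ free, (ans x).val w' .const = (ans x).val w .const)
    {m : ℕ} (hm : m < chaseRank T A (g.map (QTerm.val w .const)))
    (hg' : Chase T A m (g'.map (QTerm.val w' .const)))
    (hc : ∀ c, g'.Mem (.const c) → g.Mem (.const c)) :
    Matches T A free K s ans (insert g' (b.erase g)) w' ∧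
      weight T A (insert g' (b.erase g)) w' < weight T A b w := by
  have key : ∀ f ∈ b, f.map (QTerm.val w' .const) = f.map (QTerm.val w .const) :=
    fun f hf => Fact.map_congr (hw f hf)
  refine ⟨⟨fun f hf => ?_, fun x hx => (hans x hx).trans (h.ans_val x hx), fun f hf c hfc => ?_,
    h.ans_const⟩, ?_⟩
  · rcases Finset.mem_insert.1 hf with rfl | hf
    · exact ⟨m, hg'⟩
    · rw [key f (Finset.mem_of_mem_erase hf)]
      exact h.chase f (Finset.mem_of_mem_erase hf)
  · rcases Finset.mem_insert.1 hf with rfl | hf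
    · exact h.body_const g hg c (hc c hfc)
    · exact h.body_const f (Finset.mem_of_mem_erase hf) c hfc
  · have h₁ : weight T A (insert g' (b.erase g)) w' ≤
        chaseRank T A (g'.map (QTerm.val w' .const)) +
          ∑ f ∈ b.erase g, chaseRank T A (f.map (QTerm.val w' .const)) := by
      unfold weight
      by_cases hi : g' ∈ b.erase g
      · rw [Finset.insert_eq_of_mem hi]; omega
      · rw [Finset.sum_insert hi]
    have h₂ : ∑ f ∈ b.erase g, chaseRank T A (f.map (QTerm.val w' .const)) =
        ∑ f ∈ b.erase g, chaseRank T A (f.map (QTerm.val w .const)) :=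
      Finset.sum_congr rfl fun f hf => by rw [key f (Finset.mem_of_mem_erase hf)]
    have h₃ : weight T A b w = chaseRank T A (g.map (QTerm.val w .const)) +
        ∑ f ∈ b.erase g, chaseRank T A (f.map (QTerm.val w .const)) :=
      (Finset.add_sum_erase b _ hg).symm
    have := hg'.chaseRank_le
    omega

open Classical in
-- By `hw` all images stay the same. Two atoms become one, so a positive summand disappears; further
-- coincidences only lower the sum.
theorem Matches.reduce (h : Matches T A free K s ans b w) {g₁ g₂ : Fact CN RN (QTerm Cst)}
    (h₁ : g₁ ∈ b) (h₂ : g₂ ∈ b) (hne : g₁ ≠ g₂) {σ : ℕ → QTerm Cst} (hσ : Unifies σ g₁ g₂)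
    (hw : ∀ x, (σ x).val w .const = w x) (hK : ∀ x c, σ x = .const c → c ∈ K) :
    Matches T A free K s (fun x => (ans x).subst σ) (b.image fun g => g.map (QTerm.subst σ)) w ∧
      weight T A (b.image fun g => g.map (QTerm.subst σ)) w < weight T A b w := by
  have key : ∀ f : Fact CN RN (QTerm Cst),
      (f.map (QTerm.subst σ)).map (QTerm.val w .const) = f.map (QTerm.val w .const) := by
    intro f
    rw [Fact.map_map]
    exact Fact.map_congr fun t _ => QTerm.val_subst hw t
  have hconst : ∀ {t : QTerm Cst} {c}, t.subst σ = .const c → t = .const c ∨ c ∈ K := by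
    intro t c ht
    cases t with
    | var x => exact .inr (hK x c ht)
    | const c' => exact .inl ht
  refine ⟨⟨?_, fun x hx => (QTerm.val_subst hw _).trans (h.ans_val x hx), ?_, fun x hx c hc => ?_⟩,
    ?_⟩
  · simp only [Finset.mem_image]
    rintro _ ⟨f, hf, rfl⟩
    rw [key]
    exact h.chase f hf
  · simp only [Finset.mem_image]
    rintro _ ⟨f, hf, rfl⟩ c hc
    obtain ⟨t, ht, e⟩ := Fact.mem_map.1 hc
    rcases hconst e with rfl | hc
    · exact h.body_const f hf c ht
    · exact hc
  · exact (hconst hc).elim (h.ans_const x hx c) id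
  · have e₁ : (b.image fun g => g.map (QTerm.subst σ)) =
        (b.erase g₂).image fun g => g.map (QTerm.subst σ) := by
      refine Finset.Subset.antisymm (fun f hf => ?_)
        (Finset.image_subset_image (Finset.erase_subset _ _))
      obtain ⟨g, hg, rfl⟩ := Finset.mem_image.1 hf
      by_cases hgg : g = g₂
      · subst hgg
        exact Finset.mem_image.2 ⟨g₁, Finset.mem_erase.2 ⟨hne, h₁⟩, hσ⟩
      · exact Finset.mem_image.2 ⟨g, Finset.mem_erase.2 ⟨hgg, hg⟩, rfl⟩
    have e₂ : weight T A ((b.erase g₂).image fun g => g.map (QTerm.subst σ)) w ≤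
        ∑ f ∈ b.erase g₂, chaseRank T A (f.map (QTerm.val w .const)) := by
      refine (Finset.sum_image_le_of_nonneg fun _ _ => Nat.zero_le _).trans_eq ?_
      exact Finset.sum_congr rfl fun f _ => by rw [key]
    have e₃ : weight T A b w = chaseRank T A (g₂.map (QTerm.val w .const)) +
        ∑ f ∈ b.erase g₂, chaseRank T A (f.map (QTerm.val w .const)) :=
      (Finset.add_sum_erase b _ h₂).symm
    obtain ⟨n, hn⟩ := h.chase g₂ h₂
    have := hn.chase_chaseRank.pos
    rw [e₁]
    omega

theorem exists_fresh (free : Finset ℕ) (ans : ℕ → QTerm Cst) (b : CQ CN RN Cst) :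
    ∃ z, (⟨ans, (b : Set (Fact CN RN (QTerm Cst)))⟩ : RQuery CN RN Cst).Fresh free z := by
  have hfin : ({t : QTerm Cst | ∃ g ∈ b, g.Mem t} ∪ ans '' (free : Set ℕ)).Finite := by
    refine .union ?_ (free.finite_toSet.image _)
    have : {t : QTerm Cst | ∃ g ∈ b, g.Mem t} = ⋃ g ∈ b, {t | g.Mem t} := by ext; simp
    rw [this]
    exact b.finite_toSet.biUnion fun g _ => g.finite_mem
  obtain ⟨z, hz⟩ := (hfin.preimage (f := QTerm.var)
    (fun x _ y _ e => by cases e; rfl)).exists_notMem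
  refine ⟨z, fun h => hz (.inl h), fun a ha e => hz (.inr ⟨a, ha, e⟩)⟩

/-- A step of the rewriting that makes the match strictly smaller. -/
def Improves (T : Set (TAssertion CN RN)) (A : ABox CN RN Cst) (free : Finset ℕ)
    (K : Set Cst) (s : ℕ → Cst) (ans : ℕ → QTerm Cst) (b : CQ CN RN Cst)
    (w : ℕ → SkTerm RN Cst) : Prop :=
  ∃ (ans' : ℕ → QTerm Cst) (b' : CQ CN RN Cst) (w' : ℕ → SkTerm RN Cst),
    RewStep T free ⟨ans, b⟩ ⟨ans', b'⟩ ∧ Matches T A free K s ans' b' w' ∧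
      weight T A b' w' < weight T A b w

open Classical in
-- The fresh variable of the rewriting step is sent to the witness `y` of the premise; as it occurs
-- nowhere else, nothing else changes.
theorem Matches.improves_concept (h : Matches T A free K s ans b w) {B₁ B₂ : Concept CN RN}
    {u v : QTerm Cst} (hT : TAssertion.conceptIncl B₁ B₂ ∈ T) (hg : B₂.atom u v ∈ b)
    (hy : ∀ R, B₂ = .ex R →
      (⟨ans, b⟩ : RQuery CN RN Cst).Unbound free (B₂.atom u v) u v)
    {y : SkTerm RN Cst} {m : ℕ}
    (hm : m < chaseRank T A ((B₂.atom u v).map (QTerm.val w .const)))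
    (hc : Chase T A m (B₁.atom (u.val w .const) y)) : Improves T A free K s ans b w := by
  obtain ⟨z, hz⟩ := exists_fresh free ans b
  have hval : ∀ t : QTerm Cst, t ≠ .var z →
      t.val (Function.update w z y) SkTerm.const = t.val w .const := by
    intro t ht
    cases t with
    | var x =>
      have : x ≠ z := fun e => ht (e ▸ rfl)
      exact Function.update_of_ne this _ _
    | const c => rfl
  have hu : (B₂.atom u v).Mem u := Concept.mem_atom u v B₂
  have hval' : ∀ g ∈ b, ∀ t, g.Mem t →
      t.val (Function.update w z y) SkTerm.const = t.val w .const :=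
    fun g hg t ht => hval t fun e => hz.1 ⟨g, hg, e ▸ ht⟩
  have hstep : RewStep T free ⟨ans, b⟩
      ⟨ans, (insert (B₁.atom u (.var z)) (b.erase (B₂.atom u v)) : CQ CN RN Cst)⟩ := by
    rw [Finset.coe_insert, Finset.coe_erase]
    exact .concept hT hg hy hz
  refine ⟨ans, _, Function.update w z y, hstep, h.replace hg hval' (fun x hx => hval _ (hz.2 x hx))
    hm ?_ fun c hc => ?_⟩
  · rw [Concept.map_atom, hval' _ hg u hu, QTerm.val, Function.update_self]
    exact hc
  · rcases Concept.eq_or_eq_of_mem_atom hc with e | e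
    · rwa [e]
    · cases e

open Classical in
theorem Matches.improves_role (h : Matches T A free K s ans b w) {R₁ R₂ : Role RN}
    {u v : QTerm Cst} (hT : TAssertion.roleIncl R₁ R₂ ∈ T) (hg : R₂.atom u v ∈ b) {m : ℕ}
    (hm : m < chaseRank T A ((R₂.atom u v).map (QTerm.val w .const)))
    (hc : Chase T A m (R₁.atom (u.val w .const) (v.val w .const))) :
    Improves T A free K s ans b w := by
  have hstep : RewStep T free ⟨ans, b⟩
      ⟨ans, (insert (R₁.atom u v) (b.erase (R₂.atom u v)) : CQ CN RN Cst)⟩ := by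
    rw [Finset.coe_insert, Finset.coe_erase]
    exact .role hT hg
  refine ⟨ans, _, w, hstep, h.replace hg (fun _ _ _ _ => rfl) (fun _ _ => rfl) hm ?_ ?_⟩
  · rwa [Role.map_atom]
  · simp

open Classical in
theorem Matches.improves_reduce (h : Matches T A free K s ans b w)
    {g₁ g₂ : Fact CN RN (QTerm Cst)} (h₁ : g₁ ∈ b) (h₂ : g₂ ∈ b) (hne : g₁ ≠ g₂)
    (e : g₁.map (QTerm.val w SkTerm.const) = g₂.map (QTerm.val w SkTerm.const)) :
    Improves T A free K s ans b w := by
  obtain ⟨σ, hσ, hw, hc⟩ := exists_isMGU (fun c c' h => by cases h; rfl) e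
  have hstep : RewStep T free ⟨ans, b⟩ ⟨fun x => (ans x).subst σ,
      (b.image fun g => g.map (QTerm.subst σ) : CQ CN RN Cst)⟩ := by
    rw [Finset.coe_image]
    exact .reduce h₁ h₂ hσ
  exact ⟨_, _, w, hstep, h.reduce h₁ h₂ hne hσ.1 hw fun x c hx =>
    (hc x c hx).elim (h.body_const _ h₁ c) (h.body_const _ h₂ c)⟩

/-- Nesting depth of the terms of a fact. -/
def Fact.depth : Fact CN RN (SkTerm RN Cst) → ℕ
  | .concept _ t => t.depth
  | .role _ t t' => max t.depth t'.depth

theorem Role.depth_atom_succ (R S : Role RN) (x : SkTerm RN Cst) :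
    (R.atom x (.succ S x) : Fact CN RN (SkTerm RN Cst)).depth = x.depth + 1 := by
  cases R <;> simp [Role.atom, Fact.depth, SkTerm.depth]

/-- A match that no step improves is a match in the ABox. -/
theorem Matches.mem_abox (h : Matches T A free K s ans b w)
    (hi : ¬ Improves T A free K s ans b w) :
    ∀ g ∈ b, ∃ a ∈ A, g.map (QTerm.val w SkTerm.const) = a.map .const := by
  classical
  -- Inclusions into concept names and roles are always applicable, so for an atom outside the ABox
  -- the last inference must have created a Skolem successor.
  have hgen : ∀ g ∈ b, (∃ a ∈ A, g.map (QTerm.val w SkTerm.const) = a.map .const) ∨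
      ∃ B R u v y, TAssertion.conceptIncl B (.ex R) ∈ T ∧ g = R.atom u v ∧
        v.val w .const = .succ R (u.val w .const) ∧
        ∃ m < chaseRank T A (g.map (QTerm.val w .const)),
          Chase T A m (B.atom (u.val w .const) y) := by
    intro g hg
    obtain ⟨n, hn⟩ := h.chase g hg
    rcases hn.cases_chaseRank with h' | ⟨B, N, x, y, hT, e, m, hm, hc⟩ |
      ⟨R₁, R₂, x, y, hT, e, m, hm, hc⟩ | ⟨B, R, x, y, hT, e, m, hm, hc⟩
    · exact .inl h'
    · obtain ⟨u, rfl, rfl⟩ := Fact.map_eq_concept e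
      exact absurd (h.improves_concept (B₂ := .name N) (v := u) hT hg (by simp) hm hc) hi
    · obtain ⟨u, v, rfl, rfl, rfl⟩ := Role.map_eq_atom e
      exact absurd (h.improves_role hT hg hm hc) hi
    · obtain ⟨u, v, rfl, rfl, hv⟩ := Role.map_eq_atom e
      exact .inr ⟨B, R, u, v, y, hT, rfl, hv, m, hm, hc⟩
  by_contra hne
  push Not at hne
  obtain ⟨g₀, hg₀, hA₀⟩ := hne
  -- Among the atoms outside the ABox, one with an image of greatest depth has an unbound second
  -- argument, so that the existential inclusion applies to it.
  obtain ⟨g, hg, hmax⟩ := Finset.exists_max_image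
    (b.filter fun g => ¬ ∃ a ∈ A, g.map (QTerm.val w SkTerm.const) = a.map .const)
    (fun g => (g.map (QTerm.val w SkTerm.const)).depth)
    ⟨g₀, Finset.mem_filter.2 ⟨hg₀, fun ⟨a, ha, e⟩ => hA₀ a ha e⟩⟩
  obtain ⟨hgb, hgA⟩ := Finset.mem_filter.1 hg
  obtain ⟨B, R, u, v, y, hT, rfl, hv, m, hm, hc⟩ := (hgen g hgb).resolve_left hgA
  refine hi (h.improves_concept (B₂ := .ex R) (u := u) (v := v) hT hgb ?_ hm hc)
  rintro _ -
  refine ⟨?_, ?_, ?_, ?_⟩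
  · cases v with
    | var x => exact ⟨x, rfl⟩
    | const c => cases hv
  · rintro rfl
    exact SkTerm.succ_ne _ _ hv.symm
  · rintro a ha rfl
    cases hv.symm.trans (h.ans_val a ha)
  -- Another atom containing `v` is not in the ABox either, so its second argument is also sent to a
  -- Skolem successor. If `v` has the value of its first argument, its image is deeper, against
  -- maximality; otherwise both atoms have the same image and can be unified.
  · intro g' hg' hne p hp
    have hv' : (g'.map (QTerm.val w SkTerm.const)).Mem (.succ R (u.val w .const)) :=
      Fact.mem_map.2 ⟨v, ⟨p, hp⟩, hv⟩
    have hA' : ¬ ∃ a ∈ A, g'.map (QTerm.val w SkTerm.const) = a.map .const := by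
      rintro ⟨a, -, e⟩
      rw [e] at hv'
      obtain ⟨c, -, hc⟩ := Fact.mem_map.1 hv'
      cases hc
    have hdepth := hmax g' (Finset.mem_filter.2 ⟨hg', hA'⟩)
    obtain ⟨B', R', u', v', y', -, rfl, hv₂, -⟩ := (hgen g' hg').resolve_left hA'
    rw [Role.map_atom] at hv'
    simp only [Role.map_atom, hv, hv₂, Role.depth_atom_succ] at hdepth
    rcases Role.mem_atom.1 hv' with e | e
    · rw [← e, SkTerm.depth] at hdepth
      omega
    · rw [hv₂] at e
      refine hi (h.improves_reduce hg' hgb hne ?_)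
      injection e with e₁ e₂
      rw [Role.map_atom, Role.map_atom, hv₂, hv, e₁, e₂]

/-- The constant that a term stands for, with a default value. -/
def SkTerm.toConst (c₀ : Cst) : SkTerm RN Cst → Cst
  | .const c => c
  | .succ _ _ => c₀

/-- Induction on the weight. Once no step improves the match, Skolem terms are values only of
variables absent from the body and the answer, and an arbitrary constant may replace them. -/
theorem Matches.exists_rewriting [Nonempty Cst] (h : Matches T A free K s ans b w) :
    ∃ r, Relation.ReflTransGen (RewStep T free) ⟨ans, b⟩ r ∧ ∃ v : ℕ → Cst,
      (∀ g ∈ r.body, g.map (QTerm.val v id) ∈ A) ∧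
      (∀ x ∈ free, (r.ans x).val v id = s x) ∧ ∀ x ∈ free, ∀ c, r.ans x = .const c → c ∈ K := by
  induction hN : weight T A b w using Nat.strong_induction_on generalizing ans b w with
  | _ N ih =>
  by_cases hi : Improves T A free K s ans b w
  · obtain ⟨ans', b', w', hstep, h', hlt⟩ := hi
    obtain ⟨r, hr, H⟩ := ih _ (hN ▸ hlt) h' rfl
    exact ⟨r, .head hstep hr, H⟩
  · obtain ⟨c₀⟩ := ‹Nonempty Cst›
    have key : ∀ t : QTerm Cst, t.val (fun x => (w x).toConst c₀) id =
        (t.val w SkTerm.const).toConst c₀ := by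
      intro t
      cases t <;> rfl
    refine ⟨_, .refl, fun x => (w x).toConst c₀, fun g hg => ?_, fun x hx => ?_, h.ans_const⟩
    · obtain ⟨a, ha, e⟩ := h.mem_abox hi g hg
      have e' := congrArg (Fact.map (SkTerm.toConst c₀)) e
      rw [Fact.map_map, Fact.map_map] at e'
      have ha' : a.map (SkTerm.toConst c₀ ∘ SkTerm.const (RN := RN)) = a := by
        cases a <;> rfl
      rw [Fact.map_congr (k := SkTerm.toConst c₀ ∘ QTerm.val w SkTerm.const) fun t _ => key t,
        e', ha']
      exact ha
    · exact (key _).trans (congrArg _ (h.ans_val x hx))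

/-- Completeness of the perfect rewriting: a certain answer over a consistent ABox is an answer of
some query of the rewriting over the ABox. -/
theorem UCQ.Certain.exists_rew [Nonempty Cst] {q : UCQ CN RN Cst} (h : q.Certain T A s)
    (hT : IsDLLiteA T) (hA : Consistent T A)
    (hK : ∀ d ∈ q.disjuncts, ∀ g ∈ d, ∀ c, g.Mem (.const c) → c ∈ K) :
    ∃ r ∈ rew T q, ∃ v : ℕ → Cst, (∀ g ∈ r.body, g.map (QTerm.val v id) ∈ A) ∧
      (∀ x ∈ q.free, (r.ans x).val v id = s x) ∧
      ∀ x ∈ q.free, ∀ c, r.ans x = .const c → c ∈ K := by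
  obtain ⟨d, hd, w, hw, hsat⟩ := h _ (canonical_isModel hT hA)
  have hm : Matches T A q.free K s QTerm.var d w :=
    ⟨fun g hg => canonical_satFact.1 (hsat g hg), hw, hK d hd, fun x _ c hc => by cases hc⟩
  obtain ⟨r, hr, H⟩ := hm.exists_rewriting
  exact ⟨r, ⟨d, hd, hr⟩, H⟩

/-- Some query of the rewriting locates the values of all variables in the ABox. -/
theorem UCQ.Certain.exists_takesFrom [Nonempty Cst] {q : UCQ CN RN Cst} (h : q.Certain T A s)
    (hT : IsDLLiteA T) (hA : Consistent T A)
    (hK : ∀ d ∈ q.disjuncts, ∀ g ∈ d, ∀ c, g.Mem (.const c) → c ∈ K) :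
    ∃ r ∈ rew T q, ∀ x, s x ∈ adom A →
      s x ∈ K ∨ ∃ p, CKAB.TakesFrom q r x p ∧ ∃ g ∈ A, g.OccursAt p (s x) := by
  obtain ⟨r, hr, v, hbody, hans, hconst⟩ := h.exists_rew hT hA hK
  refine ⟨r, hr, fun x ⟨g₀, hg₀, p₀, hp₀⟩ => ?_⟩
  by_cases hx : x ∈ q.free
  · have hv := hans x hx
    cases hy : r.ans x with
    | const c =>
      rw [hy] at hv
      exact .inl (hv ▸ hconst x hx c hy)
    | var y =>
      rw [hy] at hv
      by_cases ho : r.Occurs (.var y)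
      · obtain ⟨g, hg, p, hp⟩ := ho
        refine .inr ⟨p, .inr ⟨y, hy, fun _ => ⟨g, hg, hp⟩⟩, _, hbody g hg, ?_⟩
        rw [← hv]
        exact hp.map _
      -- An unrestricted variable takes values from every position, in particular from the one where
      -- its value happens to stand.
      · exact .inr ⟨p₀, .inr ⟨y, hy, fun h => absurd h ho⟩, g₀, hg₀, hp₀⟩
  · exact .inr ⟨p₀, .inl hx, g₀, hg₀, hp₀⟩

end Rewriting

/-! ### Closure under service calls -/

section ServiceCalls

variable {Cst F : Type u} {ar : F → ℕ}

/-- Add the results of all service calls with arguments in the given set. -/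
def callStep (M : SCall Cst ar → Cst) (U : Set Cst) : Set Cst :=
  U ∪ M '' {k | ∀ i, k.args i ∈ U}

theorem subset_callStep (M : SCall Cst ar → Cst) (U : Set Cst) : U ⊆ callStep M U :=
  Set.subset_union_left

theorem monotone_callStep_iterate (M : SCall Cst ar → Cst) (U : Set Cst) :
    Monotone fun n => (callStep M)^[n] U :=
  monotone_nat_of_le_succ fun n => by
    rw [Function.iterate_succ_apply']
    exact subset_callStep M _

/-- At most `n ^ ar f` argument tuples are available for each `f`. The bound must not depend on `M`,
which varies with the run. -/
theorem exists_encard_callStep_le [Finite F] (n : ℕ) :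
    ∃ n' : ℕ, ∀ (M : SCall Cst ar → Cst) (U : Set Cst),
      U.encard ≤ n → (callStep M U).encard ≤ n' := by
  classical
  have := Fintype.ofFinite F
  refine ⟨n + ∑ f, n ^ ar f, fun M U hU => ?_⟩
  obtain ⟨S, rfl⟩ := (Set.finite_of_encard_le_coe hU).exists_finset_coe
  rw [Set.encard_coe_eq_coe_finsetCard, Nat.cast_le] at hU
  let I : Finset (Σ f, Fin (ar f) → Cst) :=
    Finset.univ.sigma fun f => Fintype.piFinset fun _ => S
  have hsub : M '' {k | ∀ i, k.args i ∈ (S : Set Cst)} ⊆ (I.image fun k => M ⟨k.1, k.2⟩) := by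
    rintro _ ⟨k, hk, rfl⟩
    simp only [Finset.coe_image]
    exact ⟨⟨k.fn, k.args⟩, by simpa [I] using hk, rfl⟩
  have hI : I.card ≤ ∑ f, n ^ ar f := by
    rw [Finset.card_sigma]
    refine Finset.sum_le_sum fun f _ => ?_
    rw [Fintype.card_piFinset_const]
    exact Nat.pow_le_pow_left hU _
  have h₁ : (M '' {k | ∀ i, k.args i ∈ (S : Set Cst)}).encard ≤ ((∑ f, n ^ ar f : ℕ) : ℕ∞) := by
    refine (Set.encard_le_encard hsub).trans ?_
    rw [Set.encard_coe_eq_coe_finsetCard, Nat.cast_le]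
    exact Finset.card_image_le.trans hI
  calc (callStep M S).encard ≤ (S : Set Cst).encard + _ := Set.encard_union_le _ _
    _ ≤ (n : ℕ∞) + ((∑ f, n ^ ar f : ℕ) : ℕ∞) := by
        refine add_le_add ?_ h₁
        rwa [Set.encard_coe_eq_coe_finsetCard, Nat.cast_le]
    _ = _ := by push_cast; rfl

theorem exists_encard_callStep_iterate_le [Finite F] (j n : ℕ) :
    ∃ n' : ℕ, ∀ (M : SCall Cst ar → Cst) (U : Set Cst),
      U.encard ≤ n → ((callStep M)^[j] U).encard ≤ n' := by
  induction j with
  | zero => exact ⟨n, fun _ _ h => h⟩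
  | succ j ih =>
    obtain ⟨n₁, h₁⟩ := ih
    obtain ⟨n₂, h₂⟩ := exists_encard_callStep_le (Cst := Cst) (ar := ar) n₁
    refine ⟨n₂, fun M U hU => ?_⟩
    rw [Function.iterate_succ_apply']
    exact h₂ M _ (h₁ M U hU)

/-- Constants of a head term. -/
def HTerm.consts : HTerm Cst ar → Set Cst
  | .base t => {c | t = .const c}
  | .call _ args => {c | ∃ i, args i = .const c}

theorem QTerm.finite_consts (t : QTerm Cst) : {c | t = .const c}.Finite :=
  Set.Subsingleton.finite fun c hc c' hc' => by
    cases (show t = .const c from hc).symm.trans hc'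
    rfl

theorem HTerm.finite_consts (t : HTerm Cst ar) : t.consts.Finite := by
  cases t with
  | base t => exact t.finite_consts
  | call f args =>
    refine (Set.finite_iUnion fun i => (args i).finite_consts).subset ?_
    rintro c ⟨i, hi⟩
    exact Set.mem_iUnion.2 ⟨i, hi⟩

/-- Value of a head term when service calls are answered by `M`. -/
def HTerm.value (M : SCall Cst ar → Cst) (s : ℕ → Cst) : HTerm Cst ar → Cst
  | .base t => t.val s id
  | .call f args => M ⟨f, fun i => (args i).val s id⟩

theorem QTerm.val_mem {t : QTerm Cst} {s : ℕ → Cst} {U : Set Cst}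
    (hc : ∀ c, t = .const c → c ∈ U) (hv : ∀ x, t = .var x → s x ∈ U) : t.val s id ∈ U := by
  cases t with
  | var x => exact hv x rfl
  | const c => exact hc c rfl

end ServiceCalls

/-! ### Facts over the extended signature -/

section Lift

variable {CN RN Cst : Type u} {A B : ABox CN RN Cst}

theorem Fact.lift_injective :
    Function.Injective (Fact.lift : Fact CN RN Cst → Fact (Option CN) RN (Option Cst)) := by
  intro g g' h
  cases g <;> cases g' <;> simp_all [Fact.lift]

@[simp] theorem ABox.lift_mem_lift {g : Fact CN RN Cst} : g.lift ∈ A.lift ↔ g ∈ A := by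
  classical
  rw [ABox.lift, Fact.lift_injective.mem_finset_image]

theorem Fact.lift_ne (g : Fact CN RN Cst) : g.lift ≠ .concept none none := by
  cases g <;> simp [Fact.lift]

@[simp] theorem ABox.lift_mem_mark {g : Fact CN RN Cst} : g.lift ∈ A.mark ↔ g ∈ A := by
  simp [ABox.mark, Fact.lift_ne]

theorem ABox.lift_injective (h : A.lift = B.lift) : A = B := by
  ext g
  rw [← ABox.lift_mem_lift, h, ABox.lift_mem_lift]

theorem ABox.mark_ne_lift : A.mark ≠ B.lift := by
  classical
  intro h
  have : Fact.concept none none ∈ B.lift := h ▸ Finset.mem_insert_self _ _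
  obtain ⟨g, -, hg⟩ := Finset.mem_image.1 this
  exact g.lift_ne hg

theorem adom_mark_subset : adom A.mark ⊆ insert none (some '' adom A) := by
  classical
  rintro o ⟨g, hg, p, hp⟩
  rcases Finset.mem_insert.1 hg with rfl | hg
  · cases hp
    exact .inl rfl
  · obtain ⟨g, hgA, rfl⟩ := Finset.mem_image.1 hg
    cases g <;> cases hp <;> exact .inr ⟨_, ⟨_, hgA, _, by constructor⟩, rfl⟩

theorem adom_lift_subset : adom A.lift ⊆ insert none (some '' adom A) := by
  classical
  rintro o ⟨g, hg, p, hp⟩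
  exact adom_mark_subset ⟨g, Finset.mem_insert_of_mem hg, p, hp⟩

theorem Fact.finite_positions {Tm : Type u} (g : Fact CN RN Tm) :
    {p | ∃ t, g.OccursAt p t}.Finite := by
  cases g with
  | concept N x =>
    refine (Set.finite_singleton (Position.concept N)).subset ?_
    rintro _ ⟨_, ⟨⟩⟩
    rfl
  | role P x y =>
    refine (Set.toFinite {Position.fst P, Position.snd P}).subset ?_
    rintro _ ⟨_, ⟨⟩⟩ <;> simp

theorem finite_adom (A : ABox CN RN Cst) : (adom A).Finite := by
  refine (A.finite_toSet.biUnion fun g _ => g.finite_mem).subset ?_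
  rintro c ⟨g, hg, hc⟩
  exact Set.mem_biUnion hg hc

end Lift

/-! ### Ranks of positions -/

namespace CKAB

variable {D : Type} {V : D → ValueDomain} {CN RN Cst F : Type u} {ar : F → ℕ}
  (K : CKAB V CN RN Cst ar)

/-- Positions that a special edge leads to. -/
def specialTargets : Set (Position CN RN) := {p' | ∃ p, K.SpecialEdge p p'}

theorem finite_specialTargets : K.specialTargets.Finite := by
  refine (K.actions_finite.biUnion fun α _ => α.effects.finite_toSet.biUnion fun e _ =>
    e.facts.finite_toSet.biUnion fun g _ => g.finite_positions).subset ?_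
  rintro p' ⟨p, α, hα, e, he, C, r, hr, g, hg, f, args, x, h, -⟩
  simp only [Set.mem_iUnion]
  exact ⟨α, hα, e, he, g, hg, _, h⟩

/-- Paths of the dependency graph. -/
def Path : Position CN RN → Position CN RN → Prop :=
  Relation.ReflTransGen fun a b => K.OrdinaryEdge a b ∨ K.SpecialEdge a b

/-- Number of targets of special edges from which there is a path to the position. -/
noncomputable def rank (p : Position CN RN) : ℕ := {t ∈ K.specialTargets | K.Path t p}.ncard

theorem rank_le (p : Position CN RN) : K.rank p ≤ K.specialTargets.ncard :=
  Set.ncard_le_ncard (Set.sep_subset _ _) K.finite_specialTargets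

variable {K}

theorem OrdinaryEdge.rank_le {p p' : Position CN RN} (h : K.OrdinaryEdge p p') :
    K.rank p ≤ K.rank p' :=
  Set.ncard_le_ncard (fun _ ht => ⟨ht.1, .tail ht.2 (.inl h)⟩)
    (K.finite_specialTargets.subset (Set.sep_subset _ _))

/-- Paths to `p` extend to `p'`. Moreover `p'` is counted for itself but not for `p`, since a path
from `p'` to `p` would close a cycle through the special edge. -/
theorem SpecialEdge.rank_lt (hK : K.WeaklyAcyclic) {p p' : Position CN RN}
    (h : K.SpecialEdge p p') : K.rank p < K.rank p' := by
  refine Set.ncard_lt_ncard ⟨fun _ ht => ⟨ht.1, .tail ht.2 (.inr h)⟩, fun hsub => ?_⟩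
    (K.finite_specialTargets.subset (Set.sep_subset _ _))
  exact hK _ _ h (hsub ⟨⟨p, h⟩, .refl⟩).2

/-! ### Values along runs -/

variable (K)

/-- Constants in the queries and heads of the effects. -/
def effectConsts : Set Cst :=
  {c | ∃ α ∈ K.actions, ∃ e ∈ α.effects,
    (∃ d ∈ e.pos.disjuncts, ∃ g ∈ d, g.Mem (.const c)) ∨
      ∃ g ∈ e.facts, ∃ t, g.Mem t ∧ c ∈ t.consts}

theorem finite_effectConsts : K.effectConsts.Finite := by
  have h₁ : ∀ g : Fact CN RN (QTerm Cst), {c | g.Mem (.const c)}.Finite := fun g =>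
    g.finite_mem.preimage (f := QTerm.const) fun _ _ _ _ e => by cases e; rfl
  refine (K.actions_finite.biUnion fun α _ => α.effects.finite_toSet.biUnion fun e _ =>
    (e.pos.disjuncts.finite_toSet.biUnion fun d _ => d.finite_toSet.biUnion fun g _ => h₁ g).union
      (e.facts.finite_toSet.biUnion fun g _ =>
        g.finite_mem.biUnion fun t _ => t.finite_consts)).subset ?_
  rintro c ⟨α, hα, e, he, h⟩
  simp only [Set.mem_iUnion, Set.mem_union]
  refine ⟨α, hα, e, he, h.imp ?_ ?_⟩
  · rintro ⟨d, hd, g, hg, h⟩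
    exact ⟨d, hd, g, hg, h⟩
  · rintro ⟨g, hg, t, ht, h⟩
    exact ⟨g, hg, t, ht, h⟩

/-- The constants that the CKAB mentions. -/
def initConsts : Set Cst := adom K.abox₀ ∪ K.effectConsts

variable {K} {A A' : ABox CN RN Cst} {m m' : SMap Cst ar} {C : Context V}
  {α : Action CN RN Cst ar} {σ : α.Subst} {M : SCall Cst ar → Cst}

/-- Every occurrence of a constant after an action is produced by the head of an effect. -/
theorem Exec.exists_effect (h : K.Exec A m C α σ A' m') (hM : ∀ k c, m' k = some c → M k = c)
    {g : Fact CN RN Cst} (hg : g ∈ A') {p : Position CN RN} {c : Cst} (hp : g.OccursAt p c) :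
    ∃ e ∈ α.effects, ∃ s : ℕ → Cst, ∃ g₀ ∈ e.facts, ∃ t, g₀.OccursAt p t ∧
      (∀ x, t.HasVar x → s x ∈ adom A) ∧ e.pos.Certain (K.tbox.inCtx C) A s ∧ t.value M s = c := by
  obtain ⟨⟨r, hr, rfl, ⟨s₀, hs₀, hans⟩, -⟩, θ, -, hagree, hA', hm'⟩ := h
  obtain ⟨_, ⟨e, he, s, hs, hfree, heval, g₀, hg₀, rfl⟩, hres⟩ := (hA' g).1 hg
  have hocc := hp.map some
  rw [← hres, Fact.map_map] at hocc
  obtain ⟨t, ht, hval⟩ := hocc.of_map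
  refine ⟨e, he, s, g₀, hg₀, t, ht, fun x hx => ?_, heval.1, ?_⟩
  · by_cases hpar : x ∈ r.action.params
    · rw [hs ⟨x, hpar⟩, ← hs₀ ⟨x, hpar⟩]
      exact hans.1 x (K.process_params r hr ▸ hpar)
    · refine hfree x ?_ hpar
      exact (Finset.mem_union.1 (r.action.facts_scope e he g₀ hg₀ p t ht x hx)).resolve_right hpar
  · cases t with
    | base t => exact Option.some_injective _ hval
    | call f args =>
      change θ ⟨f, fun i => (args i).val s id⟩ = some c at hval
      refine hM _ _ ?_
      rw [hm']
      -- Whether the call is new or remembered from `m`, its entry in `m'` is the answer given by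
      -- `θ`.
      cases hk : m ⟨f, fun i => (args i).val s id⟩ with
      | none => simpa using hval
      | some c' => simp [hagree _ _ _ hval hk]

/-- A crude bound without consistency, by the mere fact that variables take values in the active
domain; it serves for actions on an inconsistent initial ABox. -/
theorem Exec.mem_callStep (h : K.Exec A m C α σ A' m') (hM : ∀ k c, m' k = some c → M k = c)
    (hα : α ∈ K.actions) {U : Set Cst} (hU : K.effectConsts ⊆ U) (hA : adom A ⊆ U)
    {g : Fact CN RN Cst} (hg : g ∈ A') {p : Position CN RN} {c : Cst} (hp : g.OccursAt p c) :
    c ∈ callStep M U := by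
  obtain ⟨e, he, s, g₀, hg₀, t, ht, hvar, -, rfl⟩ := h.exists_effect hM hg hp
  have hc : ∀ c ∈ t.consts, c ∈ U := fun c hc => hU ⟨α, hα, e, he, .inr ⟨g₀, hg₀, t, ⟨p, ht⟩, hc⟩⟩
  cases t with
  | base t => exact .inl (QTerm.val_mem hc fun x hx => hA (hvar x hx))
  | call f args =>
    exact .inr ⟨_, fun i => QTerm.val_mem (fun c h => hc c ⟨i, h⟩)
      fun x hx => hA (hvar x ⟨i, hx⟩), rfl⟩

/-- Bound for the values at a position: the closure of the constants of the CKAB under nested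
service calls, up to a depth given by the rank of the position. -/
def reachable (K : CKAB V CN RN Cst ar) (M : SCall Cst ar → Cst) (n : ℕ) : Set Cst :=
  (callStep M)^[n] K.initConsts

theorem monotone_reachable : Monotone (K.reachable M) := monotone_callStep_iterate M _

/-- By consistency some rewritten query locates each variable at a position with an edge to `p`,
unless its value is a constant of the effects. A copied value comes from a position of no greater
rank. An argument of a call comes from a position of smaller rank, so it needs at most `rank p`
rounds, and the call is the last one. -/
theorem Exec.mem_reachable [Nonempty Cst] (hK : K.WeaklyAcyclic) (h : K.Exec A m C α σ A' m')
    (hM : ∀ k c, m' k = some c → M k = c) (hα : α ∈ K.actions)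
    (hC : Consistent (K.tbox.inCtx C) A)
    (hA : ∀ g ∈ A, ∀ p c, g.OccursAt p c → c ∈ K.reachable M (K.rank p + 1))
    {g : Fact CN RN Cst} (hg : g ∈ A') {p : Position CN RN} {c : Cst} (hp : g.OccursAt p c) :
    c ∈ K.reachable M (K.rank p + 1) := by
  obtain ⟨e, he, s, g₀, hg₀, t, ht, hvar, hcert, rfl⟩ := h.exists_effect hM hg hp
  have hinit : ∀ n, K.effectConsts ⊆ K.reachable M n := fun n =>
    Set.subset_union_right.trans (monotone_reachable (Nat.zero_le n))
  have hc : ∀ n, ∀ c ∈ t.consts, c ∈ K.reachable M n :=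
    fun n c hc => hinit n ⟨α, hα, e, he, .inr ⟨g₀, hg₀, t, ⟨p, ht⟩, hc⟩⟩
  obtain ⟨r, hr, hfrom⟩ := hcert.exists_takesFrom (K.tbox_dlLiteA C) hC (K := K.effectConsts)
    fun d hd g hg c hc => ⟨α, hα, e, he, .inl ⟨d, hd, g, hg, hc⟩⟩
  cases t with
  | base t =>
    refine QTerm.val_mem (hc _) fun x hx => ?_
    rcases hfrom x (hvar x hx) with h | ⟨p', hx', g', hg', hp'⟩
    · exact hinit _ h
    · have hE : K.OrdinaryEdge p' p := ⟨α, hα, e, he, C, r, hr, g₀, hg₀, x, hx ▸ ht, hx'⟩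
      exact monotone_reachable (Nat.add_le_add_right hE.rank_le 1) (hA g' hg' p' _ hp')
  | call f args =>
    rw [reachable, Function.iterate_succ_apply']
    change _ ∈ callStep M (K.reachable M (K.rank p))
    refine .inr ⟨⟨f, fun i => (args i).val s id⟩, fun i => ?_, rfl⟩
    refine QTerm.val_mem (fun c h => hc _ c ⟨i, h⟩) fun x hx => ?_
    rcases hfrom x (hvar x ⟨i, hx⟩) with h | ⟨p', hx', g', hg', hp'⟩
    · exact hinit _ h
    · have hE : K.SpecialEdge p' p :=
        ⟨α, hα, e, he, C, r, hr, g₀, hg₀, f, args, x, ht, ⟨i, hx⟩, hx'⟩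
      exact monotone_reachable (hE.rank_lt hK) (hA g' hg' p' _ hp')

/-- The invariant of runs.  Only the initial ABox may be inconsistent. -/
structure Invariant (K : CKAB V CN RN Cst ar) (M : SCall Cst ar → Cst)
    (S : State V CN RN Cst ar) : Prop where
  form : ∃ A : ABox CN RN Cst, S.abox = A.lift ∨ S.abox = A.mark
  mem : ∀ g : Fact CN RN Cst, g.lift ∈ S.abox → ∀ p c, g.OccursAt p c →
    c ∈ K.reachable M (K.rank p + 1)
  consistent : ∀ A : ABox CN RN Cst, S.abox = A.lift →
    Consistent (K.tbox.inCtx S.cntx) A ∨ adom A ⊆ K.initConsts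

theorem invariant_initState : K.Invariant M K.initState where
  form := ⟨_, .inl rfl⟩
  mem g hg p c hp := monotone_reachable (Nat.zero_le _)
    (.inl ⟨g, ABox.lift_mem_lift.1 hg, p, hp⟩)
  consistent A h := by
    rw [← ABox.lift_injective h]
    exact .inr Set.subset_union_left

theorem Trans.invariant [Nonempty Cst] (hK : K.WeaklyAcyclic) {S S' : State V CN RN Cst ar}
    (h : K.Trans S S') (hS : K.Invariant M S) (hM : ∀ k c, S'.smap k = some c → M k = c) :
    K.Invariant M S' := by
  cases h with
  | action hα h _ =>
    refine ⟨⟨_, .inr rfl⟩, fun g hg p c hp => ?_, fun A hA => absurd hA ABox.mark_ne_lift⟩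
    rw [ABox.lift_mem_mark] at hg
    rcases hS.consistent _ rfl with hC | hA
    · exact h.mem_reachable hK hM hα hC
        (fun g hg => hS.mem g (ABox.lift_mem_lift.2 hg)) hg hp
    -- All values of `A` are initial constants here, so a single round suffices, and `rank p + 1` is
    -- at least 1.
    · exact monotone_reachable (Nat.le_add_left 1 _)
        (h.mem_callStep hM hα Set.subset_union_right hA hg hp)
  | context h hC =>
    refine ⟨⟨_, .inl rfl⟩, fun g hg => hS.mem g ?_, fun A hA => ?_⟩
    · exact ABox.lift_mem_mark.2 (ABox.lift_mem_lift.1 hg)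
    · rw [← ABox.lift_injective hA]
      exact .inl hC

theorem Trans.smap_eq_some {S S' : State V CN RN Cst ar} (h : K.Trans S S') {k : SCall Cst ar}
    {c : Cst} (hc : S.smap k = some c) : S'.smap k = some c := by
  cases h with
  | action _ h _ =>
    obtain ⟨-, θ, -, -, -, hm'⟩ := h
    change _ = _ at hc
    simp only at hc ⊢
    rw [hm', hc]
    rfl
  | context => exact hc

/-- The answers to the service calls of a run are given by one function. -/
theorem exists_serviceMap [Nonempty Cst] (τ : K.transSys.Run) :
    ∃ M : SCall Cst ar → Cst, ∀ i : ℕ, (i : ℕ∞) ≤ τ.len →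
      ∀ k c, (τ.st i).smap k = some c → M k = c := by
  have hmono : ∀ i j : ℕ, i ≤ j → (j : ℕ∞) ≤ τ.len → ∀ k c,
      (τ.st i).smap k = some c → (τ.st j).smap k = some c := by
    intro i j hij
    induction j, hij using Nat.le_induction with
    | base => exact fun _ _ _ h => h
    | succ j _ ih =>
      intro hj k c hc
      have hlt : (j : ℕ∞) < τ.len := lt_of_lt_of_le (by exact_mod_cast Nat.lt_succ_self j) hj
      exact (τ.step j hlt).2.smap_eq_some (ih hlt.le k c hc)
  -- Service maps only grow along the run, so two answers to one call are compared in the later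
  -- state. Calls that are never made get an arbitrary value.
  have hex : ∀ k, ∃ c, ∀ i : ℕ, (i : ℕ∞) ≤ τ.len → ∀ c', (τ.st i).smap k = some c' → c = c' := by
    intro k
    by_cases h : ∃ (i : ℕ) (c : Cst), (i : ℕ∞) ≤ τ.len ∧ (τ.st i).smap k = some c
    · obtain ⟨i, c, hi, hc⟩ := h
      refine ⟨c, fun j hj c' hc' => Option.some_injective _ ?_⟩
      rcases le_total i j with hij | hij
      · rw [← hc', hmono i j hij hj k c hc]
      · rw [← hc, hmono j i hij hi k c' hc']
    · exact ⟨Classical.arbitrary Cst, fun i hi c hc => absurd ⟨i, c, hi, hc⟩ h⟩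
  choose M hM using hex
  exact ⟨M, fun i hi k c hc => hM k i hi c hc⟩

/-- No rank exceeds the number of special targets, so one closure covers all positions; `none`
accounts for the constant `inter` of intermediate states. -/
theorem run_values_subset [Nonempty Cst] (hK : K.WeaklyAcyclic) (τ : K.transSys.Run) :
    ∃ M : SCall Cst ar → Cst,
      τ.values ⊆ insert none (some '' K.reachable M (K.specialTargets.ncard + 1)) := by
  obtain ⟨M, hM⟩ := exists_serviceMap τ
  have hinv : ∀ i : ℕ, (i : ℕ∞) ≤ τ.len → K.Invariant M (τ.st i) := by
    intro i
    induction i with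
    | zero =>
      intro _
      rw [τ.start]
      exact invariant_initState
    | succ i ih =>
      intro hi
      have hlt : (i : ℕ∞) < τ.len := lt_of_lt_of_le (by exact_mod_cast Nat.lt_succ_self i) hi
      exact (τ.step i hlt).2.invariant hK (ih hlt.le) (hM _ hi)
  refine ⟨M, ?_⟩
  rintro o ⟨i, hi, ho⟩
  have hS := hinv i hi
  obtain ⟨A, hA⟩ := hS.form
  have hsub : adom A ⊆ K.reachable M (K.specialTargets.ncard + 1) := by
    rintro c ⟨g, hg, p, hp⟩
    refine monotone_reachable (Nat.add_le_add_right (K.rank_le p) 1) (hS.mem g ?_ p c hp)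
    rcases hA with hA | hA
    · rw [hA]; exact ABox.lift_mem_lift.2 hg
    · rw [hA]; exact ABox.lift_mem_mark.2 hg
  refine Set.insert_subset_insert (Set.image_mono hsub) ?_
  change o ∈ adom (τ.st i).abox at ho
  rcases hA with hA | hA
  · exact adom_lift_subset (hA ▸ ho)
  · exact adom_mark_subset (hA ▸ ho)

end CKAB

end Ckab

/-! ### The uniform bound. -/

theorem theorem2 {D : Type} [Finite D] (V : D → Ckab.ValueDomain)
    {CN RN Cst F : Type u} [Countable Cst] [Infinite Cst] [Finite F] (ar : F → ℕ)
    (K : Ckab.CKAB V CN RN Cst ar) (hK : K.WeaklyAcyclic) :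
    K.transSys.RunBounded := by
  have hfin : K.initConsts.Finite := (Ckab.finite_adom _).union K.finite_effectConsts
  obtain ⟨n, hn⟩ := Ckab.exists_encard_callStep_iterate_le (Cst := Cst) (ar := ar)
    (K.specialTargets.ncard + 1) K.initConsts.ncard
  -- One is added to `n` for `inter`, and one because the inequality is strict.
  refine ⟨n + 2, fun τ => ?_⟩
  obtain ⟨M, hM⟩ := Ckab.CKAB.run_values_subset hK τ
  calc τ.values.encard ≤ _ := Set.encard_le_encard hM
    _ ≤ _ + 1 := Set.encard_insert_le _ _
    _ ≤ (n : ℕ∞) + 1 := by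
        gcongr
        exact (Set.encard_image_le _ _).trans (hn M _ hfin.cast_ncard_eq.ge)
    _ < ((n + 2 : ℕ) : ℕ∞) := by exact_mod_cast Nat.lt_succ_self (n + 1)
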